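/- Let $\ell,m,n,N\ge 1$ be integers, let $P_0\in\mathbb{R}^{m\times n}$ and $P_k(i)\in\mathbb{R}^{m\times n}$ ($1\le k\le \ell$, $1\le i\le N$) be constant matrices, and consider the linear differential operator and its formal adjoint $$\mathcal{F}w=P_0w+\sum_{k=1}^{\ell}\sum_{i=1}^{N}P_k(i)\,\partial_k^i w,\qquad \mathcal{F}^*v=P_0^\top v+\sum_{k=1}^{\ell}\sum_{i=1}^{N}(-1)^iP_k(i)^\top\partial_k^i v,$$ where $\partial_k^i=\partial^i/\partial x_k^i$. Let $\Omega\subset\mathbb{R}^\ell$ be a bounded open set with Lipschitz boundary (near each boundary point, $\Omega$ is, in suitable orthonormal coordinates, the region below the graph of a Lipschitz function), let $d\mathtt{s}$ be the surface measure on $\partial\Omega$ (the normalized $(\ell-1)$-dimensional Hausdorff measure), and let $\hat n(\mathtt{s})=(\hat n_1(\mathtt{s}),\dots,\hat n_\ell(\mathtt{s}))$ be the outward unit normal vector to $\partial\Omega$. It exists at almost every $\mathtt{s}\in\partial\Omega$. Let $v:\overline\Omega\to\mathbb{R}^m$ and $w:\overline\Omega\to\mathbb{R}^n$ be of class $C^N$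 up to the boundary. Then all the integrands below are integrable, and $$\int_\Omega\left(v^\top\mathcal{F}w-w^\top\mathcal{F}^*v\right)d\mathtt{x}=\sum_{k=1}^{\ell}\sum_{i=1}^{N}\sum_{j=1}^{i}(-1)^{j-1}\int_{\partial\Omega}\partial_k^{i-j}w(\mathtt{s})^\top P_k(i)^\top\hat n_k(\mathtt{s})\,\partial_k^{j-1}v(\mathtt{s})\,d\mathtt{s}=\int_{\partial\Omega}\mathcal{B}(w(\mathtt{s}))^\top\mathcal{Q}_\partial(\mathtt{s})\,\mathcal{B}(v(\mathtt{s}))\,d\mathtt{s}.$$ Here $\mathcal{B}(f)$ is the column vector that stacks $f,\ \partial_1f,\dots,\partial_\ell f,\ \partial_1^2f,\dots,\partial_\ell^2f,\ \dots,\ \partial_1^{N-1}f,\dots,\partial_\ell^{N-1}f$, and $\mathcal{Q}_\partial(\mathtt{s})$ is the real matrix of size $(n+(N-1)n\ell)\times(m+(N-1)m\ell)$ given by $$\mathcal{Q}_\partial=\begin{bmatrix}P_\partial&-W_2&W_3&\cdots&(-1)^{N-1}W_N\\V_2&-\Lambda_3&\Lambda_4&\cdots&0\\V_3&-\Lambda_4&\Lambda_5&\cdots&0\\\vdots&\vdots&\vdots&&\vdots\\V_N&0&0&\cdots&0\end{bmatrix},$$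 that is, the first block row is $P_\partial,-W_2,\dots,(-1)^{N-1}W_N$, the first block column is $P_\partial,V_2,\dots,V_N$, and for $2\le r,c\le N$ the block in row $r$ and column $c$ is $(-1)^{c-1}\Lambda_{r+c-1}$ if $r+c-1\le N$ and $0$ otherwise. The blocks are $$P_\partial=\sum_{k=1}^{\ell}P_k(1)^\top\hat n_k,\qquad W_i=\begin{bmatrix}P_1(i)^\top\hat n_1&\cdots&P_\ell(i)^\top\hat n_\ell\end{bmatrix},\qquad V_i=\begin{bmatrix}P_1(i)^\top\hat n_1\\\vdots\\P_\ell(i)^\top\hat n_\ell\end{bmatrix},$$ and $\Lambda_i$ is the block diagonal matrix with diagonal blocks $P_1(i)^\top\hat n_1,\dots,P_\ell(i)^\top\hat n_\ell$. -/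

import Mathlib

open MeasureTheory Matrix
open scoped Topology NNReal

noncomputable section

/-- A bounded Lipschitz open subset of `ℝ^ℓ`: near each of its boundary points it is, in suitable
orthonormal coordinates, the region lying below the graph of a Lipschitz function. Here `ν` is the
vertical direction and `g` is a function on the hyperplane orthogonal to `ν`. -/
structure IsBoundedLipschitz {ℓ : ℕ} (Ω : Set (EuclideanSpace ℝ (Fin ℓ))) : Prop where
  isOpen : IsOpen Ω
  isBounded : Bornology.IsBounded Ω
  graph : ∀ p ∈ frontier Ω, ∃ (ν : EuclideanSpace ℝ (Fin ℓ)) (g : (ℝ ∙ ν)ᗮ → ℝ) (K : ℝ≥0) (r : ℝ),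
    ‖ν‖ = 1 ∧ LipschitzWith K g ∧ 0 < r ∧
      ∀ x ∈ Metric.ball p r, x ∈ Ω ↔ inner ℝ ν x < g ((ℝ ∙ ν)ᗮ.orthogonalProjectionOnto x)

/-- `ν` is the outward unit normal vector to the boundary of `Ω` at `s`: inside every open cone with
apex `s` and axis `-ν` that is narrower than a half-space, all points close to `s` belong to `Ω`, and
inside every such cone with axis `ν` all points close to `s` lie outside `Ω`. -/
def IsOutwardUnitNormal {ℓ : ℕ} (Ω : Set (EuclideanSpace ℝ (Fin ℓ)))
    (s ν : EuclideanSpace ℝ (Fin ℓ)) : Prop :=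
  ‖ν‖ = 1 ∧ ∀ ε : ℝ, 0 < ε → ∀ᶠ x in 𝓝 s,
    (inner ℝ ν (x - s) < -(ε * ‖x - s‖) → x ∈ Ω) ∧ (ε * ‖x - s‖ < inner ℝ ν (x - s) → x ∉ Ω)

/-- There is at most one outward unit normal vector at a given point. -/
theorem IsOutwardUnitNormal.unique {ℓ : ℕ} {Ω : Set (EuclideanSpace ℝ (Fin ℓ))}
    {s ν ν' : EuclideanSpace ℝ (Fin ℓ)} (h : IsOutwardUnitNormal Ω s ν)
    (h' : IsOutwardUnitNormal Ω s ν') : ν = ν' := by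
  by_contra hne
  have hd : 0 < ‖ν' - ν‖ := norm_pos_iff.mpr (sub_ne_zero.mpr (Ne.symm hne))
  set d := ν' - ν with hd_def
  have hsq : ‖d‖ ^ 2 = 2 - 2 * inner ℝ ν ν' := by
    rw [hd_def, @norm_sub_sq_real, h.1, h'.1, real_inner_comm]; ring
  have h1 : inner ℝ ν d = -(‖d‖ ^ 2 / 2) := by
    rw [hsq, hd_def, inner_sub_right, real_inner_self_eq_norm_sq, h.1]; ring
  have h2 : inner ℝ ν' d = ‖d‖ ^ 2 / 2 := by
    rw [hsq, hd_def, inner_sub_right, real_inner_self_eq_norm_sq, h'.1, real_inner_comm]; ring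
  have hε : 0 < ‖d‖ / 4 := by positivity
  have htend : Filter.Tendsto (fun t : ℝ => s + t • d) (𝓝[>] 0) (𝓝 s) := by
    have : Continuous (fun t : ℝ => s + t • d) := by fun_prop
    have h0 := this.tendsto 0
    simp only [zero_smul, add_zero] at h0
    exact h0.mono_left nhdsWithin_le_nhds
  have key := (htend.eventually ((h.2 _ hε).and (h'.2 _ hε))).and self_mem_nhdsWithin
  obtain ⟨t, ⟨⟨ha, -⟩, -, hb⟩, ht⟩ := key.exists
  have ht' : 0 < t := ht
  simp only [add_sub_cancel_left, norm_smul, inner_smul_right, Real.norm_eq_abs, abs_of_pos ht',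
    h1, h2] at ha hb
  have hp : 0 < t * ‖d‖ ^ 2 := by positivity
  exact hb (by nlinarith) (ha (by nlinarith))

open Classical in
/-- The outward unit normal vector `n̂(s)` to the boundary of `Ω` at `s` (and `0` at the points where
there is none). -/
def outwardNormal {ℓ : ℕ} (Ω : Set (EuclideanSpace ℝ (Fin ℓ))) (s : EuclideanSpace ℝ (Fin ℓ)) :
    EuclideanSpace ℝ (Fin ℓ) :=
  if h : ∃ ν, IsOutwardUnitNormal Ω s ν then h.choose else 0

/-- The surface measure on the boundary of `Ω`: the `(ℓ-1)`-dimensional Hausdorff measure, normalized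
so that it is the Lebesgue measure on hyperplanes, restricted to the boundary. -/
def surfaceMeasure {ℓ : ℕ} (Ω : Set (EuclideanSpace ℝ (Fin ℓ))) :
    Measure (EuclideanSpace ℝ (Fin ℓ)) :=
  (Measure.euclideanHausdorffMeasure (ℓ - 1)).restrict (frontier Ω)

/-- The iterated partial derivative `∂_k^i f` of a function `f` on the set `S`, where derivatives are
taken within `S`. With `S` the closure of an open set, these are the usual partial derivatives in the
open set, and derivatives from the inside at the points of its boundary. -/
def pderivOn {ℓ d : ℕ} (S : Set (EuclideanSpace ℝ (Fin ℓ))) (k : Fin ℓ) :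
    ℕ → (EuclideanSpace ℝ (Fin ℓ) → Fin d → ℝ) → EuclideanSpace ℝ (Fin ℓ) → Fin d → ℝ
  | 0, f => f
  | i + 1, f => fun x => fderivWithin ℝ (pderivOn S k i f) S x (EuclideanSpace.single k 1)

/-- The differential operator `F w = P₀ w + ∑ k, ∑ i = 1..N, P_k(i) ∂_k^i w`. -/
def diffOp {ℓ m n : ℕ} (S : Set (EuclideanSpace ℝ (Fin ℓ))) (N : ℕ) (P₀ : Matrix (Fin m) (Fin n) ℝ)
    (P : Fin ℓ → ℕ → Matrix (Fin m) (Fin n) ℝ) (w : EuclideanSpace ℝ (Fin ℓ) → Fin n → ℝ)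
    (x : EuclideanSpace ℝ (Fin ℓ)) : Fin m → ℝ :=
  P₀ *ᵥ w x + ∑ k : Fin ℓ, ∑ i ∈ Finset.Icc 1 N, P k i *ᵥ pderivOn S k i w x

/-- The formal adjoint `F* v = P₀ᵀ v + ∑ k, ∑ i = 1..N, (-1)^i P_k(i)ᵀ ∂_k^i v`. -/
def diffOpAdjoint {ℓ m n : ℕ} (S : Set (EuclideanSpace ℝ (Fin ℓ))) (N : ℕ)
    (P₀ : Matrix (Fin m) (Fin n) ℝ) (P : Fin ℓ → ℕ → Matrix (Fin m) (Fin n) ℝ)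
    (v : EuclideanSpace ℝ (Fin ℓ) → Fin m → ℝ) (x : EuclideanSpace ℝ (Fin ℓ)) : Fin n → ℝ :=
  P₀ᵀ *ᵥ v x +
    ∑ k : Fin ℓ, ∑ i ∈ Finset.Icc 1 N, ((-1 : ℝ) ^ i • (P k i)ᵀ) *ᵥ pderivOn S k i v x

/-- Row and column indices of stacked vectors `(f, ∂_1 f, …, ∂_ℓ f, …, ∂_1^(N-1) f, …, ∂_ℓ^(N-1) f)`
with `f` valued in `ℝ^d`: the pair `(j, k, a)` on the right stands for the component `a` of
`∂_k^(j+1) f`. -/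
abbrev StackIdx (ℓ N d : ℕ) : Type := Fin d ⊕ (Fin (N - 1) × Fin ℓ × Fin d)

/-- The stacked-derivative operator `B`. -/
def stackOp {ℓ d : ℕ} (S : Set (EuclideanSpace ℝ (Fin ℓ))) (N : ℕ)
    (f : EuclideanSpace ℝ (Fin ℓ) → Fin d → ℝ) (x : EuclideanSpace ℝ (Fin ℓ)) :
    StackIdx ℓ N d → ℝ :=
  Sum.elim (f x) fun q => pderivOn S q.2.1 (q.1 + 1) f x q.2.2

section Blocks

variable {ℓ m n : ℕ} (P : Fin ℓ → ℕ → Matrix (Fin m) (Fin n) ℝ) (ν : EuclideanSpace ℝ (Fin ℓ))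

/-- `P_∂ = ∑ k, P_k(1)ᵀ n̂_k`. -/
def blockP : Matrix (Fin n) (Fin m) ℝ :=
  ∑ k : Fin ℓ, ν k • (P k 1)ᵀ

/-- The block row `W_i = [P_1(i)ᵀ n̂_1 ⋯ P_ℓ(i)ᵀ n̂_ℓ]`. -/
def blockW (i : ℕ) : Matrix (Fin n) (Fin ℓ × Fin m) ℝ :=
  Matrix.of fun a q => (ν q.1 • (P q.1 i)ᵀ) a q.2

/-- The block column `V_i` with blocks `P_1(i)ᵀ n̂_1, …, P_ℓ(i)ᵀ n̂_ℓ`. -/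
def blockV (i : ℕ) : Matrix (Fin ℓ × Fin n) (Fin m) ℝ :=
  Matrix.of fun p b => (ν p.1 • (P p.1 i)ᵀ) p.2 b

/-- The block diagonal matrix `Λ_i` with diagonal blocks `P_1(i)ᵀ n̂_1, …, P_ℓ(i)ᵀ n̂_ℓ`. -/
def blockΛ (i : ℕ) : Matrix (Fin ℓ × Fin n) (Fin ℓ × Fin m) ℝ :=
  Matrix.of fun p q => if p.1 = q.1 then (ν p.1 • (P p.1 i)ᵀ) p.2 q.2 else 0

/-- The boundary matrix `Q_∂` for the normal vector `ν`. Its first block row is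
`P_∂, -W_2, W_3, …, (-1)^(N-1) W_N`, its first block column is `P_∂, V_2, …, V_N`, and the remaining
block in the block row of `V_r` and the block column of `W_c` is `(-1)^(c-1) Λ_(r+c-1)` if
`r + c - 1 ≤ N`, and zero otherwise. The numbers `r.1` and `c.1` below start from zero, so that they
are `r - 2` and `c - 2` in this description. -/
def boundaryMatrix (N : ℕ) : Matrix (StackIdx ℓ N n) (StackIdx ℓ N m) ℝ :=
  Matrix.fromBlocks
    (blockP P ν)
    (Matrix.of fun a c => (-1 : ℝ) ^ (c.1.1 + 1) * blockW P ν (c.1.1 + 2) a c.2)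
    (Matrix.of fun r b => blockV P ν (r.1.1 + 2) r.2 b)
    (Matrix.of fun r c =>
      if r.1.1 + c.1.1 + 3 ≤ N then
        (-1 : ℝ) ^ (c.1.1 + 1) * blockΛ P ν (r.1.1 + c.1.1 + 3) r.2 c.2
      else 0)

end Blocks

/-- The volume integrand `vᵀ F w - wᵀ F* v`. -/
def volumeIntegrand {ℓ m n : ℕ} (S : Set (EuclideanSpace ℝ (Fin ℓ))) (N : ℕ)
    (P₀ : Matrix (Fin m) (Fin n) ℝ) (P : Fin ℓ → ℕ → Matrix (Fin m) (Fin n) ℝ)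
    (v : EuclideanSpace ℝ (Fin ℓ) → Fin m → ℝ) (w : EuclideanSpace ℝ (Fin ℓ) → Fin n → ℝ)
    (x : EuclideanSpace ℝ (Fin ℓ)) : ℝ :=
  v x ⬝ᵥ diffOp S N P₀ P w x - w x ⬝ᵥ diffOpAdjoint S N P₀ P v x

/-- The boundary integrand `(∂_k^(i-j) w)ᵀ P_k(i)ᵀ n̂_k ∂_k^(j-1) v`. -/
def boundaryIntegrand {ℓ m n : ℕ} (Ω : Set (EuclideanSpace ℝ (Fin ℓ)))
    (P : Fin ℓ → ℕ → Matrix (Fin m) (Fin n) ℝ)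
    (v : EuclideanSpace ℝ (Fin ℓ) → Fin m → ℝ) (w : EuclideanSpace ℝ (Fin ℓ) → Fin n → ℝ)
    (k : Fin ℓ) (i j : ℕ) (s : EuclideanSpace ℝ (Fin ℓ)) : ℝ :=
  pderivOn (closure Ω) k (i - j) w s ⬝ᵥ
    ((outwardNormal Ω s k • (P k i)ᵀ) *ᵥ pderivOn (closure Ω) k (j - 1) v s)

/-- The boundary integrand in matrix form, `B(w)ᵀ Q_∂ B(v)`. -/
def matrixIntegrand {ℓ m n : ℕ} (Ω : Set (EuclideanSpace ℝ (Fin ℓ))) (N : ℕ)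
    (P : Fin ℓ → ℕ → Matrix (Fin m) (Fin n) ℝ)
    (v : EuclideanSpace ℝ (Fin ℓ) → Fin m → ℝ) (w : EuclideanSpace ℝ (Fin ℓ) → Fin n → ℝ)
    (s : EuclideanSpace ℝ (Fin ℓ)) : ℝ :=
  stackOp (closure Ω) N w s ⬝ᵥ
    (boundaryMatrix P (outwardNormal Ω s) N *ᵥ stackOp (closure Ω) N v s)

end

/-! The theorem combines a pointwise Lagrange identity with the divergence theorem on Lipschitz
domains. By the product rule, the `k`-th partial derivative of `(∂_k^(i-j) w)ᵀ P_k(i)ᵀ ∂_k^(j-1) v`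
is the sum of two neighbouring terms of the sequence `(∂_k^(i-j) w)ᵀ P_k(i)ᵀ ∂_k^j v`. With
alternating signs the sum over `j` telescopes to the order `i` part of `vᵀ F w - wᵀ F* v`, and the
`P₀` terms cancel (`volumeIntegrand_eq_sum_fderiv`). The first equality is then
`IsBoundedLipschitz.integral_fderiv_eq` in the direction `e_k`. The second regroups the boundary sum
by the pair of derivative orders `(i - j, j - 1)` (`sum_triangle_eq_sum_blocks`).

For the divergence theorem, a partition of unity reduces to functions supported either in `Ω`, where
both sides vanish, or in a graph chart. Below a graph, the coordinates `(y, t) ↦ y + (g y + t) ν`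
preserve volume. On each slice `t < 0`, integration by parts along the slice trades the derivative
in a direction `u` for the derivative along `ν`, with the weight `⟨ν, u⟩ - Dg(Pu)`, where `P` is the
projection onto the base hyperplane. The weight does not depend on `t`, so Fubini and the
fundamental theorem of calculus leave a weighted integral over the graph
(`integral_fderiv_subgraph`).

The area formula turns this into a surface integral. It rests on Rademacher's theorem and on
comparing the graph with linear graphs on countably many pieces (`graphMap_image_measure`). The area
element `√(1 + |Dg|²)` is also the length of `ν - ∇g`, so it cancels against the normalization of
the normal vector, and the weight above becomes the component of the unit normal along `u`. -/

/-! ### Graphs over a hyperplane and the Jacobian of a linear graph. -/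

section GraphParametrization

variable {E : Type*} [NormedAddCommGroup E] [InnerProductSpace ℝ E]

/-- The parametrization `y ↦ y + g y • ν` of the graph of `g` over the hyperplane orthogonal
to `ν`. -/
def graphMap (ν : E) (g : (ℝ ∙ ν)ᗮ → ℝ) (y : (ℝ ∙ ν)ᗮ) : E :=
  (y : E) + g y • ν

theorem inner_coe_orthogonal_singleton (ν : E) (y : (ℝ ∙ ν)ᗮ) : inner ℝ ν (y : E) = 0 :=
  Submodule.mem_orthogonal_singleton_iff_inner_right.mp y.2

theorem norm_coe_add_smul_sq {ν : E} (hν : ‖ν‖ = 1) (y : (ℝ ∙ ν)ᗮ) (t : ℝ) :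
    ‖(y : E) + t • ν‖ ^ 2 = ‖y‖ ^ 2 + t ^ 2 := by
  rw [@norm_add_sq_real, inner_smul_right, real_inner_comm, inner_coe_orthogonal_singleton,
    norm_smul, hν]
  simp

theorem norm_le_norm_coe_add_smul {ν : E} (hν : ‖ν‖ = 1) (y : (ℝ ∙ ν)ᗮ) (t : ℝ) :
    ‖y‖ ≤ ‖(y : E) + t • ν‖ := by
  refine le_of_sq_le_sq ?_ (norm_nonneg _)
  rw [norm_coe_add_smul_sq hν]
  nlinarith [sq_nonneg t]

theorem inner_coe_add_smul {ν : E} (hν : ‖ν‖ = 1) (y : (ℝ ∙ ν)ᗮ) (t : ℝ) :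
    inner ℝ ν ((y : E) + t • ν) = t := by
  rw [inner_add_right, inner_coe_orthogonal_singleton, inner_smul_right,
    real_inner_self_eq_norm_sq, hν]
  simp

theorem orthogonalProjectionOnto_coe_add_smul (ν : E) (y : (ℝ ∙ ν)ᗮ) (t : ℝ) :
    (ℝ ∙ ν)ᗮ.orthogonalProjectionOnto ((y : E) + t • ν) = y := by
  rw [map_add, map_smul, Submodule.orthogonalProjectionOnto_orthogonalComplement_singleton_eq_zero,
    Submodule.orthogonalProjectionOnto_mem_subspace_eq_self]
  simp

theorem coe_orthogonalProjectionOnto_add_inner_smul {ν : E} (hν : ‖ν‖ = 1) (x : E) :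
    ((ℝ ∙ ν)ᗮ.orthogonalProjectionOnto x : E) + (inner ℝ ν x : ℝ) • ν = x := by
  have h := Submodule.starProjection_add_starProjection_orthogonal (K := ℝ ∙ ν) x
  rw [Submodule.starProjection_singleton, hν] at h
  simp only [one_pow, RCLike.ofReal_one, div_one] at h
  rw [add_comm]
  exact h

theorem inner_graphMap {ν : E} (hν : ‖ν‖ = 1) (g : (ℝ ∙ ν)ᗮ → ℝ) (y : (ℝ ∙ ν)ᗮ) :
    inner ℝ ν (graphMap ν g y) = g y :=
  inner_coe_add_smul hν y _

theorem orthogonalProjectionOnto_graphMap (ν : E) (g : (ℝ ∙ ν)ᗮ → ℝ) (y : (ℝ ∙ ν)ᗮ) :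
    (ℝ ∙ ν)ᗮ.orthogonalProjectionOnto (graphMap ν g y) = y :=
  orthogonalProjectionOnto_coe_add_smul ν y _

theorem graphMap_injective (ν : E) (g : (ℝ ∙ ν)ᗮ → ℝ) : Function.Injective (graphMap ν g) :=
  Function.LeftInverse.injective (orthogonalProjectionOnto_graphMap ν g)

theorem range_graphMap {ν : E} (hν : ‖ν‖ = 1) (g : (ℝ ∙ ν)ᗮ → ℝ) :
    Set.range (graphMap ν g) =
      {x | inner ℝ ν x = g ((ℝ ∙ ν)ᗮ.orthogonalProjectionOnto x)} := by
  ext x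
  constructor
  · rintro ⟨y, rfl⟩
    simp only [Set.mem_ofPred_eq, inner_graphMap hν, orthogonalProjectionOnto_graphMap]
  · intro hx
    refine ⟨(ℝ ∙ ν)ᗮ.orthogonalProjectionOnto x, ?_⟩
    rw [graphMap, ← Set.mem_ofPred_eq.mp hx, coe_orthogonalProjectionOnto_add_inner_smul hν]

theorem continuous_graphMap (ν : E) {g : (ℝ ∙ ν)ᗮ → ℝ} (hg : Continuous g) :
    Continuous (graphMap ν g) := by
  unfold graphMap
  fun_prop

theorem graphMap_sub (ν : E) (g : (ℝ ∙ ν)ᗮ → ℝ) (x y : (ℝ ∙ ν)ᗮ) :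
    graphMap ν g x - graphMap ν g y = ((x - y : (ℝ ∙ ν)ᗮ) : E) + (g x - g y) • ν := by
  simp only [graphMap, Submodule.coe_sub, sub_smul]
  abel

theorem graphMap_lipschitzWith {ν : E} (hν : ‖ν‖ = 1) {g : (ℝ ∙ ν)ᗮ → ℝ} {K : ℝ≥0}
    (hg : LipschitzWith K g) : LipschitzWith (1 + K) (graphMap ν g) := by
  refine LipschitzWith.of_dist_le_mul fun x y => ?_
  have h := hg.dist_le_mul x y
  rw [dist_eq_norm, graphMap_sub]
  refine (norm_add_le _ _).trans ?_
  rw [norm_smul, hν, ← Submodule.coe_norm, ← dist_eq_norm x y, ← dist_eq_norm (g x)]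
  push_cast
  linarith

/-- The linear parametrization of the graph of a linear form. -/
noncomputable def linearGraphMap (ν : E) (a : (ℝ ∙ ν)ᗮ →L[ℝ] ℝ) : (ℝ ∙ ν)ᗮ →L[ℝ] E :=
  (ℝ ∙ ν)ᗮ.subtypeL + a.smulRight ν

theorem linearGraphMap_apply (ν : E) (a : (ℝ ∙ ν)ᗮ →L[ℝ] ℝ) (y : (ℝ ∙ ν)ᗮ) :
    linearGraphMap ν a y = (y : E) + a y • ν := rfl

variable [FiniteDimensional ℝ E]

/-- If `b` is the Riesz vector of `a`, then `LᵀL` is the rank-one perturbation `x ↦ x + a(x) b` of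
the identity, whose determinant is `1 + a(b) = 1 + ‖a‖²`. -/
theorem normDet_linearGraphMap {ν : E} (hν : ‖ν‖ = 1) (a : (ℝ ∙ ν)ᗮ →L[ℝ] ℝ) :
    (linearGraphMap ν a : (ℝ ∙ ν)ᗮ →ₗ[ℝ] E).normDet = √(1 + ‖a‖ ^ 2) := by
  set L : (ℝ ∙ ν)ᗮ →ₗ[ℝ] E := (linearGraphMap ν a).toLinearMap with hL
  set b := (InnerProductSpace.toDual ℝ (ℝ ∙ ν)ᗮ).symm a with hb
  have hab : ∀ y, a y = inner ℝ b y := fun y => by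
    rw [hb, InnerProductSpace.toDual_symm_apply]
  have hna : ‖a‖ = ‖b‖ := by rw [hb, LinearIsometryEquiv.norm_map]
  have key : LinearMap.adjoint L ∘ₗ L = LinearMap.transvection (a : (ℝ ∙ ν)ᗮ →ₗ[ℝ] ℝ) b := by
    refine LinearMap.ext fun x => ext_inner_right ℝ fun y => ?_
    rw [LinearMap.comp_apply, LinearMap.adjoint_inner_left, LinearMap.transvection.apply]
    change inner ℝ (linearGraphMap ν a x) (linearGraphMap ν a y) = inner ℝ (x + a x • b) y
    simp only [linearGraphMap_apply, inner_add_left, inner_add_right, inner_smul_left,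
      inner_smul_right, inner_coe_orthogonal_singleton, real_inner_self_eq_norm_sq, hν,
      real_inner_comm ν (x : E), hab, Submodule.coe_inner]
    simp [mul_comm]
  have h := L.normDet_sq
  rw [key, LinearMap.transvection.det] at h
  have h' : L.normDet ^ 2 = 1 + ‖a‖ ^ 2 := by
    rw [hna, ← real_inner_self_eq_norm_sq, ← hab]
    exact_mod_cast h
  rw [← h', Real.sqrt_sq (LinearMap.normDet_nonneg _)]

end GraphParametrization

/-! ### The area formula for Lipschitz graphs. -/

section AreaFormula

/-- The hypothesis makes `f ∘ h⁻¹` well defined and `K`-Lipschitz on `h '' A`, for any choice of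
preimages. Comparing two images, rather than an image with `A`, lets a graph be measured against its
linear model in both directions. -/
theorem euclideanHausdorffMeasure_image_le_of_edist_le {ι X Y : Type*}
    [EMetricSpace X] [MeasurableSpace X] [BorelSpace X]
    [EMetricSpace Y] [MeasurableSpace Y] [BorelSpace Y] {f : ι → X} {h : ι → Y} {A : Set ι}
    {K : ℝ≥0} (hfh : ∀ x ∈ A, ∀ y ∈ A, edist (f x) (f y) ≤ K * edist (h x) (h y)) (d : ℕ) :
    (Measure.euclideanHausdorffMeasure d) (f '' A) ≤
      (K : ENNReal) ^ d * (Measure.euclideanHausdorffMeasure d) (h '' A) := by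
  rcases A.eq_empty_or_nonempty with rfl | ⟨x₀, hx₀⟩
  · simp
  have hne : Nonempty ι := ⟨x₀⟩
  set F : Y → X := fun z => f (Function.invFunOn h A z) with hF
  have hmem : ∀ x ∈ A, Function.invFunOn h A (h x) ∈ A ∧ h (Function.invFunOn h A (h x)) = h x :=
    fun x hx => Function.invFunOn_pos ⟨x, hx, rfl⟩
  have hlip : LipschitzOnWith K F (h '' A) := by
    rintro _ ⟨x, hx, rfl⟩ _ ⟨y, hy, rfl⟩
    have := hfh _ (hmem x hx).1 _ (hmem y hy).1
    rwa [(hmem x hx).2, (hmem y hy).2] at this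
  have himg : f '' A = F '' (h '' A) := by
    rw [Set.image_image]
    refine Set.image_congr fun x hx => ?_
    have := hfh _ hx _ (hmem x hx).1
    rw [(hmem x hx).2, edist_self, mul_zero, nonpos_iff_eq_zero, edist_eq_zero] at this
    exact this
  rw [himg, Measure.euclideanHausdorffMeasure_def, Measure.euclideanHausdorffMeasure_def,
    Measure.smul_apply, Measure.smul_apply]
  have := hlip.hausdorffMeasure_image_le (Nat.cast_nonneg d)
  rw [ENNReal.rpow_natCast] at this
  rw [ENNReal.smul_def, ENNReal.smul_def, smul_eq_mul, smul_eq_mul, mul_left_comm]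
  gcongr

/-- A scalar version of `ApproximatesLinearOn.norm_fderiv_sub_le`. -/
theorem ApproximatesLinearOn.norm_fderiv_sub_le_real {V : Type*} [NormedAddCommGroup V]
    [NormedSpace ℝ V] [FiniteDimensional ℝ V] [MeasurableSpace V] [BorelSpace V]
    (μ : Measure V) [μ.IsAddHaarMeasure] {g : V → ℝ} {a : V →L[ℝ] ℝ} {s : Set V} {δ : ℝ≥0}
    (hg : ApproximatesLinearOn g a s δ) (hs : MeasurableSet s) (g' : V → V →L[ℝ] ℝ)
    (hg' : ∀ x ∈ s, HasFDerivWithinAt g (g' x) s x) :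
    ∀ᵐ x ∂μ.restrict s, ‖g' x - a‖₊ ≤ δ := by
  rcases subsingleton_or_nontrivial V with hV | hV
  · refine Filter.Eventually.of_forall fun x => ?_
    rw [Subsingleton.elim (g' x - a) 0]
    simp
  obtain ⟨e, he⟩ := exists_norm_eq V zero_le_one
  -- Multiplying by the unit vector `e` turns functionals into endomorphisms of the same norm, which
  -- reduces the claim to self-maps of `V`.
  have hnorm : ∀ b : V →L[ℝ] ℝ, ‖b.smulRight e‖₊ = ‖b‖₊ := fun b => by
    ext
    simp [he]
  have hf : ApproximatesLinearOn (fun x => g x • e) (a.smulRight e) s δ := by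
    intro x hx y hy
    rw [ContinuousLinearMap.smulRight_apply, ← sub_smul, ← sub_smul, norm_smul, he, mul_one]
    exact hg x hx y hy
  filter_upwards [hf.norm_fderiv_sub_le μ hs (fun x => (g' x).smulRight e)
    fun x hx => (hg' x hx).smul_const e] with x hx
  rw [← hnorm]
  convert hx using 2
  ext y
  simp [sub_smul]

/-- After squaring, the gap is at least `2δ(1 - b + b²) + δ²b² ≥ 0`. An additive error `δ` in the
slope thus costs only a factor `1 + δ` in the area element, and a common factor passes through
countable sums. -/
theorem sqrt_one_add_sq_le_mul {a b δ : ℝ} (ha : 0 ≤ a) (hδ : 0 ≤ δ)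
    (h : a ≤ b + δ) : √(1 + a ^ 2) ≤ (1 + δ) * √(1 + b ^ 2) := by
  have h1 : 1 ≤ √(1 + b ^ 2) := Real.one_le_sqrt.mpr (by nlinarith)
  have h2 : b ≤ √(1 + b ^ 2) := Real.le_sqrt_of_sq_le (by linarith)
  have h3 : √(1 + b ^ 2) ^ 2 = 1 + b ^ 2 := Real.sq_sqrt (by positivity)
  refine Real.sqrt_le_iff.mpr ⟨by positivity, ?_⟩
  have h4 : a ^ 2 ≤ (b + δ) ^ 2 := by gcongr
  rw [mul_pow, h3]
  nlinarith [mul_nonneg hδ (sq_nonneg (b - 1)), mul_nonneg hδ hδ, sq_nonneg (δ * b)]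

/-- The area element of the graph of `g`. -/
noncomputable def areaDensity {V : Type*} [NormedAddCommGroup V] [NormedSpace ℝ V] (g : V → ℝ)
    (y : V) : ℝ :=
  √(1 + ‖fderiv ℝ g y‖ ^ 2)

theorem measurable_areaDensity {V : Type*} [NormedAddCommGroup V] [NormedSpace ℝ V]
    [MeasurableSpace V] [OpensMeasurableSpace V] (g : V → ℝ) : Measurable (areaDensity g) := by
  unfold areaDensity
  have := measurable_fderiv ℝ g
  fun_prop

variable {E : Type*} [NormedAddCommGroup E] [InnerProductSpace ℝ E]

/-- Differences of points on the two graphs differ by a vertical vector of length at most `δ‖x -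
y‖`, and `‖x - y‖`, the length of the horizontal part, is at most the length of either difference.
-/
theorem edist_graphMap_le {ν : E} (hν : ‖ν‖ = 1) {g : (ℝ ∙ ν)ᗮ → ℝ} {a : (ℝ ∙ ν)ᗮ →L[ℝ] ℝ}
    {A : Set (ℝ ∙ ν)ᗮ} {δ : ℝ≥0} (hg : ApproximatesLinearOn g a A δ) {x y : (ℝ ∙ ν)ᗮ}
    (hx : x ∈ A) (hy : y ∈ A) :
    edist (graphMap ν g x) (graphMap ν g y) ≤
        (1 + δ : ℝ≥0) * edist (linearGraphMap ν a x) (linearGraphMap ν a y) ∧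
      edist (linearGraphMap ν a x) (linearGraphMap ν a y) ≤
        (1 + δ : ℝ≥0) * edist (graphMap ν g x) (graphMap ν g y) := by
  have h := hg x hx y hy
  have h1 : graphMap ν g x - graphMap ν g y =
      linearGraphMap ν a (x - y) + (g x - g y - a (x - y)) • ν := by
    rw [graphMap_sub, linearGraphMap_apply, sub_smul (g x - g y)]
    abel
  have h2 : ‖x - y‖ ≤ ‖graphMap ν g x - graphMap ν g y‖ := by
    rw [graphMap_sub]
    exact norm_le_norm_coe_add_smul hν _ _
  have h3 : ‖x - y‖ ≤ ‖linearGraphMap ν a (x - y)‖ := norm_le_norm_coe_add_smul hν _ _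
  have h4 : ‖(g x - g y - a (x - y)) • ν‖ ≤ δ * ‖x - y‖ := by
    rwa [norm_smul, hν, mul_one]
  have h5 : ‖graphMap ν g x - graphMap ν g y‖ ≤
      ‖linearGraphMap ν a (x - y)‖ + ‖(g x - g y - a (x - y)) • ν‖ := by
    rw [h1]
    exact norm_add_le _ _
  have h6 : ‖linearGraphMap ν a (x - y)‖ ≤
      ‖graphMap ν g x - graphMap ν g y‖ + ‖(g x - g y - a (x - y)) • ν‖ := by
    rw [eq_sub_of_add_eq h1.symm]
    exact norm_sub_le _ _
  have hδ : (0 : ℝ) ≤ δ := δ.2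
  constructor
  · rw [edist_nndist, edist_nndist]
    norm_cast
    rw [← NNReal.coe_le_coe]
    push_cast
    rw [dist_eq_norm, dist_eq_norm, ← map_sub]
    nlinarith [mul_le_mul_of_nonneg_left h3 hδ]
  · rw [edist_nndist, edist_nndist]
    norm_cast
    rw [← NNReal.coe_le_coe]
    push_cast
    rw [dist_eq_norm, dist_eq_norm, ← map_sub]
    nlinarith [mul_le_mul_of_nonneg_left h2 hδ]

variable [FiniteDimensional ℝ E] [MeasurableSpace E] [BorelSpace E]

open Module in
-- The linear graph has exact measure `√(1 + ‖a‖²) · volume A`. Replacing it by the graph of `g`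
-- costs `(1 + δ)^d`, and replacing `a` by the actual derivative costs one more factor `1 + δ`,
-- whence the exponent `d + 1`.
theorem graphMap_image_measure_bounds {ν : E} (hν : ‖ν‖ = 1) {g : (ℝ ∙ ν)ᗮ → ℝ}
    {a : (ℝ ∙ ν)ᗮ →L[ℝ] ℝ} {A : Set (ℝ ∙ ν)ᗮ} {δ : ℝ≥0} (hA : MeasurableSet A)
    (hg : ApproximatesLinearOn g a A δ) (hd : ∀ y ∈ A, DifferentiableAt ℝ g y) :
    (Measure.euclideanHausdorffMeasure (finrank ℝ (ℝ ∙ ν)ᗮ)) (graphMap ν g '' A) ≤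
        ((1 + δ : ℝ≥0) : ENNReal) ^ (finrank ℝ (ℝ ∙ ν)ᗮ + 1) *
          ∫⁻ y in A, ENNReal.ofReal (areaDensity g y) ∧
      ∫⁻ y in A, ENNReal.ofReal (areaDensity g y) ≤
        ((1 + δ : ℝ≥0) : ENNReal) ^ (finrank ℝ (ℝ ∙ ν)ᗮ + 1) *
          (Measure.euclideanHausdorffMeasure (finrank ℝ (ℝ ∙ ν)ᗮ)) (graphMap ν g '' A) := by
  set d := finrank ℝ (ℝ ∙ ν)ᗮ
  set c : ENNReal := ((1 + δ : ℝ≥0) : ENNReal) with hc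
  have hc' : c = ENNReal.ofReal (1 + δ) := by
    rw [hc, ← NNReal.coe_one, ← NNReal.coe_add, ENNReal.ofReal_coe_nnreal]
  have hL := (linearGraphMap ν a :
    (ℝ ∙ ν)ᗮ →ₗ[ℝ] E).euclideanHausdorffMeasure_image_eq_normDet_mul_volume A
  rw [normDet_linearGraphMap hν] at hL
  have h1 := euclideanHausdorffMeasure_image_le_of_edist_le
    (fun x hx y hy => (edist_graphMap_le hν hg hx hy).1) d
  have h2 := euclideanHausdorffMeasure_image_le_of_edist_le
    (fun x hx y hy => (edist_graphMap_le hν hg hx hy).2) d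
  have hL' : (Measure.euclideanHausdorffMeasure d) (linearGraphMap ν a '' A) =
    ENNReal.ofReal √(1 + ‖a‖ ^ 2) * volume A := hL
  rw [hL'] at h1 h2
  have hae := hg.norm_fderiv_sub_le_real volume hA (fderiv ℝ g)
    fun x hx => (hd x hx).hasFDerivAt.hasFDerivWithinAt
  have h3 : ENNReal.ofReal √(1 + ‖a‖ ^ 2) * volume A ≤
      c * ∫⁻ y in A, ENNReal.ofReal (areaDensity g y) := by
    rw [← setLIntegral_const, ← lintegral_const_mul' _ _ ENNReal.coe_ne_top]
    refine lintegral_mono_ae ?_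
    filter_upwards [hae] with y hy
    rw [← hc, hc', ← ENNReal.ofReal_mul (by positivity)]
    refine ENNReal.ofReal_le_ofReal
      (sqrt_one_add_sq_le_mul (norm_nonneg a) δ.2 ?_)
    have : ‖fderiv ℝ g y - a‖ ≤ δ := hy
    exact (norm_le_norm_add_norm_sub (fderiv ℝ g y) a).trans (by gcongr)
  have h4 : ∫⁻ y in A, ENNReal.ofReal (areaDensity g y) ≤
      c * (ENNReal.ofReal √(1 + ‖a‖ ^ 2) * volume A) := by
    rw [← setLIntegral_const, ← lintegral_const_mul' _ _ ENNReal.coe_ne_top]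
    refine lintegral_mono_ae ?_
    filter_upwards [hae] with y hy
    rw [← hc, hc', ← ENNReal.ofReal_mul (by positivity)]
    refine ENNReal.ofReal_le_ofReal
      (sqrt_one_add_sq_le_mul (norm_nonneg (fderiv ℝ g y)) δ.2 ?_)
    have : ‖fderiv ℝ g y - a‖ ≤ δ := hy
    exact (norm_le_norm_add_norm_sub' (fderiv ℝ g y) a).trans (by gcongr)
  constructor
  · calc _ ≤ c ^ d * (ENNReal.ofReal √(1 + ‖a‖ ^ 2) * volume A) := h1
      _ ≤ c ^ d * (c * ∫⁻ y in A, ENNReal.ofReal (areaDensity g y)) := by gcongr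
      _ = _ := by rw [pow_succ, mul_assoc]
  · calc _ ≤ c * (ENNReal.ofReal √(1 + ‖a‖ ^ 2) * volume A) := h4
      _ ≤ c * (c ^ d * _) := by gcongr
      _ = _ := by rw [pow_succ', mul_assoc]

theorem ENNReal.le_of_forall_pow_one_add_mul {X Y : ENNReal} (n : ℕ)
    (h : ∀ δ : ℝ≥0, 0 < δ → X ≤ ((1 + δ : ℝ≥0) : ENNReal) ^ n * Y) : X ≤ Y := by
  have hlim : Filter.Tendsto (fun δ : ℝ≥0 => ((1 + δ : ℝ≥0) : ENNReal) ^ n * Y) (𝓝[>] 0)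
      (𝓝 (1 * Y)) := by
    refine ENNReal.Tendsto.mul_const ?_ (Or.inl one_ne_zero)
    have hcont : Continuous fun δ : ℝ≥0 => (((1 + δ) ^ n : ℝ≥0) : ENNReal) := by fun_prop
    have := (hcont.tendsto 0).mono_left (nhdsWithin_le_nhds (s := Set.Ioi 0))
    simpa using this
  rw [one_mul] at hlim
  refine ge_of_tendsto hlim ?_
  filter_upwards [self_mem_nhdsWithin] with δ hδ using h δ hδ

open Module in
-- By Rademacher the non-differentiability set is null, and the Lipschitz map `graphMap` sends it to
-- a null set. The rest splits into countably many pieces on which `g` is `δ`-close to linear; the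
-- bounds on the pieces add up, and `δ → 0` gives equality.
theorem graphMap_image_measure {ν : E} (hν : ‖ν‖ = 1) {g : (ℝ ∙ ν)ᗮ → ℝ} {K : ℝ≥0}
    (hg : LipschitzWith K g) {B : Set (ℝ ∙ ν)ᗮ} (hB : MeasurableSet B) :
    (Measure.euclideanHausdorffMeasure (finrank ℝ (ℝ ∙ ν)ᗮ)) (graphMap ν g '' B) =
      ∫⁻ y in B, ENNReal.ofReal (areaDensity g y) := by
  set d := finrank ℝ (ℝ ∙ ν)ᗮ with hd
  set D : Set (ℝ ∙ ν)ᗮ := {y | DifferentiableAt ℝ g y} with hD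
  have hDm : MeasurableSet D := measurableSet_of_differentiableAt ℝ g
  have hDae : ∀ᵐ y : (ℝ ∙ ν)ᗮ, y ∈ D := hg.ae_differentiableAt
  have hemb : MeasurableEmbedding (graphMap ν g) :=
    (continuous_graphMap ν hg.continuous).measurableEmbedding (graphMap_injective ν g)
  have hnull : (Measure.euclideanHausdorffMeasure d) (graphMap ν g '' (B \ D)) = 0 := by
    have h0 : volume (B \ D) = 0 := measure_mono_null (fun y hy => hy.2) hDae
    have h1 := euclideanHausdorffMeasure_image_le_of_edist_le (f := graphMap ν g) (h := id)
      (A := B \ D) (fun x _ y _ => graphMap_lipschitzWith hν hg x y) d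
    rw [Set.image_id, InnerProductSpace.euclideanHausdorffMeasure_eq_volume, h0, mul_zero] at h1
    exact le_antisymm h1 zero_le
  have himg : (Measure.euclideanHausdorffMeasure d) (graphMap ν g '' B) =
      (Measure.euclideanHausdorffMeasure d) (graphMap ν g '' (B ∩ D)) := by
    refine le_antisymm ?_ (measure_mono (Set.image_mono Set.inter_subset_left))
    conv_lhs => rw [← Set.inter_union_sdiff B D, Set.image_union]
    refine (measure_union_le _ _).trans ?_
    rw [hnull, add_zero]
  have hint : ∫⁻ y in B, ENNReal.ofReal (areaDensity g y) =
      ∫⁻ y in B ∩ D, ENNReal.ofReal (areaDensity g y) := by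
    refine setLIntegral_congr ?_
    filter_upwards [hDae] with y hy
    exact propext ⟨fun h => ⟨h, hy⟩, fun h => h.1⟩
  rw [himg, hint]
  have key : ∀ δ : ℝ≥0, 0 < δ →
      (Measure.euclideanHausdorffMeasure d) (graphMap ν g '' (B ∩ D)) ≤
          ((1 + δ : ℝ≥0) : ENNReal) ^ (d + 1) *
            ∫⁻ y in B ∩ D, ENNReal.ofReal (areaDensity g y) ∧
        ∫⁻ y in B ∩ D, ENNReal.ofReal (areaDensity g y) ≤
          ((1 + δ : ℝ≥0) : ENNReal) ^ (d + 1) *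
            (Measure.euclideanHausdorffMeasure d) (graphMap ν g '' (B ∩ D)) := by
    intro δ hδ
    obtain ⟨t, a, htd, htm, hcov, happ, -⟩ :=
      exists_partition_approximatesLinearOn_of_hasFDerivWithinAt g D (fderiv ℝ g)
        (fun y hy => (DifferentiableAt.hasFDerivAt hy).hasFDerivWithinAt) (fun _ => δ)
        fun _ => hδ.ne'
    set A : ℕ → Set (ℝ ∙ ν)ᗮ := fun n => B ∩ D ∩ t n with hA
    have hAm : ∀ n, MeasurableSet (A n) := fun n => (hB.inter hDm).inter (htm n)
    have hAd : Pairwise (Function.onFun Disjoint A) := fun i j hij =>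
      (htd hij).mono Set.inter_subset_right Set.inter_subset_right
    have hAU : B ∩ D = ⋃ n, A n := by
      rw [hA, ← Set.inter_iUnion]
      exact (Set.inter_eq_left.mpr (Set.inter_subset_right.trans hcov)).symm
    have hb : ∀ n, _ := fun n => graphMap_image_measure_bounds hν (hAm n)
      ((happ n).mono_set (fun y hy => ⟨hy.1.2, hy.2⟩ : A n ⊆ D ∩ t n)) fun y hy => hy.1.2
    have hM : (Measure.euclideanHausdorffMeasure d) (graphMap ν g '' (B ∩ D)) =
        ∑' n, (Measure.euclideanHausdorffMeasure d) (graphMap ν g '' (A n)) := by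
      rw [hAU, Set.image_iUnion, measure_iUnion]
      · exact fun i j hij => Set.disjoint_image_of_injective (graphMap_injective ν g) (hAd hij)
      · exact fun n => hemb.measurableSet_image.mpr (hAm n)
    have hI : ∫⁻ y in B ∩ D, ENNReal.ofReal (areaDensity g y) =
        ∑' n, ∫⁻ y in A n, ENNReal.ofReal (areaDensity g y) := by
      rw [hAU, lintegral_iUnion hAm hAd]
    rw [hM, hI, ← ENNReal.tsum_mul_left, ← ENNReal.tsum_mul_left]
    exact ⟨ENNReal.tsum_le_tsum fun n => (hb n).1, ENNReal.tsum_le_tsum fun n => (hb n).2⟩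
  exact le_antisymm (ENNReal.le_of_forall_pow_one_add_mul _ fun δ hδ => (key δ hδ).1)
    (ENNReal.le_of_forall_pow_one_add_mul _ fun δ hδ => (key δ hδ).2)

open Module in
/-- The area formula for Lipschitz graphs. -/
theorem euclideanHausdorffMeasure_restrict_range_graphMap {ν : E} (hν : ‖ν‖ = 1)
    {g : (ℝ ∙ ν)ᗮ → ℝ} {K : ℝ≥0} (hg : LipschitzWith K g) :
    (Measure.euclideanHausdorffMeasure (finrank ℝ (ℝ ∙ ν)ᗮ)).restrict
        (Set.range (graphMap ν g)) =
      (volume.withDensity fun y => ENNReal.ofReal (areaDensity g y)).map (graphMap ν g) := by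
  have hcont := continuous_graphMap ν hg.continuous
  ext S hS
  rw [Measure.map_apply hcont.measurable hS, Measure.restrict_apply hS,
    withDensity_apply _ (hcont.measurable hS), ← graphMap_image_measure hν hg
    (hcont.measurable hS), Set.image_preimage_eq_inter_range]

end AreaFormula

/-! ### Compactly supported Lipschitz functions and integrability of derivatives. -/

section CompactSupport

/-- Compactness gives a constant on the 1-thickening of the support. A point outside it has value
`0` and lies at distance more than `1` from the support, so there the sup bound `M` serves as a
Lipschitz constant. -/
theorem LocallyLipschitz.exists_lipschitzWith_of_hasCompactSupport {V : Type*}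
    [NormedAddCommGroup V] [ProperSpace V] {F : V → ℝ} (hF : LocallyLipschitz F)
    (hs : HasCompactSupport F) : ∃ K, LipschitzWith K F := by
  have hcont : Continuous F := hF.continuous
  have hS : IsCompact (Metric.cthickening 1 (tsupport F)) := IsCompact.cthickening hs
  obtain ⟨K, hK⟩ := hF.locallyLipschitzOn.exists_lipschitzOnWith_of_compact hS
  obtain ⟨M, hM⟩ := hcont.bounded_above_of_compact_support hs
  have hM0 : 0 ≤ M := (norm_nonneg _).trans (hM 0)
  have hsub := Metric.self_subset_cthickening (tsupport F) (δ := 1)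
  have key : ∀ x y, x ∈ tsupport F → dist (F x) (F y) ≤ max K M.toNNReal * dist x y := by
    intro x y hx
    by_cases hy : y ∈ Metric.cthickening 1 (tsupport F)
    · refine (hK.dist_le_mul x (hsub hx) y hy).trans ?_
      gcongr
      exact le_max_left _ _
    · have hy0 : F y = 0 := image_eq_zero_of_notMem_tsupport fun h => hy (hsub h)
      have hd : 1 < dist x y := by
        by_contra! hle
        exact hy (Metric.mem_cthickening_of_dist_le y x 1 _ hx (by rwa [dist_comm]))
      rw [hy0, dist_zero_right]
      calc ‖F x‖ ≤ M * 1 := by simpa using hM x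
        _ ≤ (max K M.toNNReal : ℝ≥0) * dist x y := by
          gcongr
          exact (Real.le_coe_toNNReal M).trans (NNReal.coe_le_coe.mpr (le_max_right _ _))
  refine ⟨max K M.toNNReal, LipschitzWith.of_dist_le_mul fun x y => ?_⟩
  by_cases hx : x ∈ tsupport F
  · exact key x y hx
  by_cases hy : y ∈ tsupport F
  · rw [dist_comm, dist_comm x]
    exact key y x hy
  rw [image_eq_zero_of_notMem_tsupport hx, image_eq_zero_of_notMem_tsupport hy, dist_self]
  positivity

theorem LipschitzWith.integral_lineDeriv_eq_zero {V : Type*} [NormedAddCommGroup V]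
    [NormedSpace ℝ V] [FiniteDimensional ℝ V] [MeasurableSpace V] [BorelSpace V]
    {μ : Measure V} [μ.IsAddHaarMeasure] {K : ℝ≥0} {F : V → ℝ} (hF : LipschitzWith K F)
    (hs : HasCompactSupport F) (v : V) : ∫ x, lineDeriv ℝ F x v ∂μ = 0 := by
  -- Integration by parts against the constant `1`; the formula reverses the direction, hence `-v`.
  have h := (LipschitzWith.const (1 : ℝ)).integral_lineDeriv_mul_eq (μ := μ) hF hs (-v)
  simpa [lineDeriv] using h.symm

theorem integrable_fderiv_apply_comp {X E : Type*} [TopologicalSpace X] [MeasurableSpace X]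
    [BorelSpace X] {μ : Measure X} [IsFiniteMeasureOnCompacts μ] [T2Space X]
    [NormedAddCommGroup E] [NormedSpace ℝ E] [MeasurableSpace E] [BorelSpace E] {h : E → ℝ}
    (hs : HasCompactSupport h) {f : X → E} (hf : Topology.IsClosedEmbedding f) {C : ℝ}
    (hC : ∀ y, ‖fderiv ℝ h (f y)‖ ≤ C) (u : E) :
    Integrable (fun y => fderiv ℝ h (f y) u) μ := by
  have hcomp : IsCompact (f ⁻¹' tsupport h) := hf.isCompact_preimage hs
  rw [← integrableOn_univ]
  refine IntegrableOn.of_forall_sdiff_eq_zero (s := f ⁻¹' tsupport h) ?_ MeasurableSet.univ ?_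
  · refine Measure.integrableOn_of_bounded (M := C * ‖u‖) hcomp.measure_lt_top.ne ?_ ?_
    · exact ((measurable_fderiv_apply_const ℝ h u).comp
        hf.continuous.measurable).aestronglyMeasurable
    · refine Filter.Eventually.of_forall fun y => ?_
      exact (fderiv ℝ h (f y)).le_of_opNorm_le (hC y) u
  · intro y hy
    rw [fderiv_of_notMem_tsupport ℝ hy.2]
    rfl

end CompactSupport

/-! ### The divergence theorem below a Lipschitz graph. -/

section SubgraphDivergence

variable {E : Type*} [NormedAddCommGroup E] [InnerProductSpace ℝ E]

theorem isClosedEmbedding_graphMap [CompleteSpace E] (ν : E) {g : (ℝ ∙ ν)ᗮ → ℝ}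
    (hg : Continuous g) : Topology.IsClosedEmbedding (graphMap ν g) :=
  Function.LeftInverse.isClosedEmbedding (orthogonalProjectionOnto_graphMap ν g)
    (ContinuousLinearMap.continuous _) (continuous_graphMap ν hg)

theorem hasFDerivAt_graphMap {ν : E} {g : (ℝ ∙ ν)ᗮ → ℝ} {y : (ℝ ∙ ν)ᗮ}
    (hg : DifferentiableAt ℝ g y) :
    HasFDerivAt (graphMap ν g) (linearGraphMap ν (fderiv ℝ g y)) y :=
  (ℝ ∙ ν)ᗮ.subtypeL.hasFDerivAt.add (hg.hasFDerivAt.smul_const ν)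

theorem isClosedEmbedding_graphMap_add [CompleteSpace E] {ν : E} (hν : ‖ν‖ = 1) {g : (ℝ ∙ ν)ᗮ → ℝ}
    (hg : Continuous g) :
    Topology.IsClosedEmbedding
      (fun z : (ℝ ∙ ν)ᗮ × ℝ => graphMap ν (fun y => g y + z.2) z.1) := by
  refine Function.LeftInverse.isClosedEmbedding (f := fun x => ((ℝ ∙ ν)ᗮ.orthogonalProjectionOnto x,
    inner ℝ ν x - g ((ℝ ∙ ν)ᗮ.orthogonalProjectionOnto x))) (fun z => ?_) ?_ ?_
  · simp only [orthogonalProjectionOnto_graphMap, inner_graphMap hν, add_sub_cancel_left]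
  · fun_prop
  · unfold graphMap
    fun_prop

variable [FiniteDimensional ℝ E] [MeasurableSpace E] [BorelSpace E]

theorem measurePreserving_coe_add_smul {ν : E} (hν : ‖ν‖ = 1) :
    MeasurePreserving (fun z : (ℝ ∙ ν)ᗮ × ℝ => (z.1 : E) + z.2 • ν) (volume.prod volume)
      volume := by
  have h1 := ((ℝ ∙ ν).measurePreserving_measurableEquivProd (0 : E)).symm
  rw [InnerProductSpace.euclideanHausdorffMeasure_eq_volume] at h1
  have h2 : MeasurePreserving (fun t : ℝ => LinearIsometryEquiv.toSpanUnitSingleton ν hν t)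
    volume volume := LinearIsometryEquiv.measurePreserving _
  have h3 := h1.comp ((h2.prod (MeasurePreserving.id (volume : Measure (ℝ ∙ ν)ᗮ))).comp
    Measure.measurePreserving_swap)
  have heq : (fun z : (ℝ ∙ ν)ᗮ × ℝ => (z.1 : E) + z.2 • ν) =
      ((ℝ ∙ ν).measurableEquivProd (0 : E)).symm ∘
        Prod.map (fun t => LinearIsometryEquiv.toSpanUnitSingleton ν hν t) id ∘ Prod.swap := by
    funext z
    simp [add_comm]
  rw [heq]
  exact h3

/-- The map is a shear followed by orthogonal coordinates. The shear translates each vertical line,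
so it preserves volume with no differentiability of `g`. -/
theorem measurePreserving_graphMap_add {ν : E} (hν : ‖ν‖ = 1) {g : (ℝ ∙ ν)ᗮ → ℝ}
    (hg : Continuous g) :
    MeasurePreserving (fun z : (ℝ ∙ ν)ᗮ × ℝ => graphMap ν (fun y => g y + z.2) z.1)
      (volume.prod volume) volume := by
  have hshear : MeasurePreserving (fun z : (ℝ ∙ ν)ᗮ × ℝ => (z.1, g z.1 + z.2))
      (volume.prod volume) (volume.prod volume) := by
    refine (MeasurePreserving.id (volume : Measure (ℝ ∙ ν)ᗮ)).skew_product
      (g := fun y t => g y + t) ?_ ?_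
    · exact ((hg.comp continuous_fst).add continuous_snd).measurable
    · exact Filter.Eventually.of_forall fun y => map_add_left_eq_self _ _
  exact (measurePreserving_coe_add_smul hν).comp hshear

/-- Tangential integration by parts on a Lipschitz graph along which `h` is `C^1` in the ambient
space. -/
theorem integral_fderiv_graphMap {ν : E} (hν : ‖ν‖ = 1) {g : (ℝ ∙ ν)ᗮ → ℝ} {K : ℝ≥0}
    (hg : LipschitzWith K g) {h : E → ℝ} (hs : HasCompactSupport h)
    (hd : ∀ y, ContDiffAt ℝ 1 h (graphMap ν g y)) {C : ℝ}
    (hC : ∀ y, ‖fderiv ℝ h (graphMap ν g y)‖ ≤ C) (u : E) :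
    ∫ y, fderiv ℝ h (graphMap ν g y) u =
      ∫ y, (inner ℝ ν u - fderiv ℝ g y ((ℝ ∙ ν)ᗮ.orthogonalProjectionOnto u)) *
        fderiv ℝ h (graphMap ν g y) ν := by
  set e := (ℝ ∙ ν)ᗮ.orthogonalProjectionOnto u with he
  have hemb := isClosedEmbedding_graphMap ν hg.continuous
  have hloc : LocallyLipschitz (h ∘ graphMap ν g) := by
    intro y
    obtain ⟨L, t, ht, hL⟩ := (hd y).exists_lipschitzOnWith
    refine ⟨L * (1 + K), graphMap ν g ⁻¹' t, hemb.continuous.continuousAt ht, ?_⟩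
    exact hL.comp ((graphMap_lipschitzWith hν hg).lipschitzOnWith) (Set.mapsTo_preimage _ _)
  have hFs : HasCompactSupport (h ∘ graphMap ν g) := hs.comp_isClosedEmbedding hemb
  obtain ⟨L, hL⟩ := hloc.exists_lipschitzWith_of_hasCompactSupport hFs
  have hint : ∀ u, Integrable (fun y => fderiv ℝ h (graphMap ν g y) u) :=
    integrable_fderiv_apply_comp hs hemb hC
  have hu : (e : E) + (inner ℝ ν u : ℝ) • ν = u := coe_orthogonalProjectionOnto_add_inner_smul hν u
  have hzero := hL.integral_lineDeriv_eq_zero (μ := volume) hFs e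
  -- Along the graph, direction `e` lifts to `e + Dg(e) ν = u - (⟨ν, u⟩ - Dg(e)) ν`. The derivative
  -- of the composite is therefore the difference of the two integrands, and its integral vanishes.
  have hae : (fun y => lineDeriv ℝ (h ∘ graphMap ν g) y e) =ᵐ[volume]
      fun y => fderiv ℝ h (graphMap ν g y) u - (inner ℝ ν u - fderiv ℝ g y e) *
        fderiv ℝ h (graphMap ν g y) ν := by
    filter_upwards [hg.ae_differentiableAt (μ := volume)] with y hy
    have hcomp := ((hd y).differentiableAt one_ne_zero).hasFDerivAt.comp y (hasFDerivAt_graphMap hy)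
    rw [hcomp.differentiableAt.lineDeriv_eq_fderiv, hcomp.fderiv]
    conv_rhs => rw [← hu]
    simp only [ContinuousLinearMap.comp_apply, linearGraphMap_apply, map_add, map_smul,
      smul_eq_mul, inner_add_right, inner_coe_orthogonal_singleton, inner_smul_right,
      real_inner_self_eq_norm_sq, hν]
    ring
  have hw : Integrable (fun y => (inner ℝ ν u - fderiv ℝ g y e) *
      fderiv ℝ h (graphMap ν g y) ν) := by
    refine (hint ν).bdd_mul (c := ‖(inner ℝ ν u : ℝ)‖ + K * ‖e‖) ?_ ?_
    · exact (measurable_const.sub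
        (measurable_fderiv_apply_const ℝ g e)).aestronglyMeasurable
    · refine Filter.Eventually.of_forall fun y => (norm_sub_le _ _).trans ?_
      gcongr
      exact (fderiv ℝ g y).le_of_opNorm_le (norm_fderiv_le_of_lipschitz ℝ hg) e
  rw [integral_congr_ae hae, integral_sub (hint u) hw, sub_eq_zero] at hzero
  exact hzero

/-- The divergence theorem in the region below a Lipschitz graph. -/
theorem integral_fderiv_subgraph {ν : E} (hν : ‖ν‖ = 1) {g : (ℝ ∙ ν)ᗮ → ℝ} {K : ℝ≥0}
    (hg : LipschitzWith K g) {h : E → ℝ} (hs : HasCompactSupport h)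
    (hcont : ContinuousOn h {x | inner ℝ ν x ≤ g ((ℝ ∙ ν)ᗮ.orthogonalProjectionOnto x)})
    (hd : ∀ x, inner ℝ ν x < g ((ℝ ∙ ν)ᗮ.orthogonalProjectionOnto x) → ContDiffAt ℝ 1 h x) {C : ℝ}
    (hC : ∀ x, inner ℝ ν x < g ((ℝ ∙ ν)ᗮ.orthogonalProjectionOnto x) → ‖fderiv ℝ h x‖ ≤ C)
    (u : E) :
    ∫ x in {x | inner ℝ ν x < g ((ℝ ∙ ν)ᗮ.orthogonalProjectionOnto x)}, fderiv ℝ h x u =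
      ∫ y, (inner ℝ ν u - fderiv ℝ g y ((ℝ ∙ ν)ᗮ.orthogonalProjectionOnto u)) *
        h (graphMap ν g y) := by
  set e := (ℝ ∙ ν)ᗮ.orthogonalProjectionOnto u with he
  set U : Set E := {x | inner ℝ ν x < g ((ℝ ∙ ν)ᗮ.orthogonalProjectionOnto x)} with hU
  set T : (ℝ ∙ ν)ᗮ × ℝ → E := fun z => graphMap ν (fun y => g y + z.2) z.1 with hT
  have hUm : MeasurableSet U := by
    refine (isOpen_lt ?_ ?_).measurableSet
    · fun_prop
    · exact hg.continuous.comp (ContinuousLinearMap.continuous _)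
  have hTmp : MeasurePreserving T (volume.prod volume) volume :=
    measurePreserving_graphMap_add hν hg.continuous
  have hTemb : Topology.IsClosedEmbedding T := isClosedEmbedding_graphMap_add hν hg.continuous
  -- In the coordinates `T` the subgraph is the half-space `t < 0`.
  have hTU : T ⁻¹' U = Set.univ ×ˢ Set.Iio (0 : ℝ) := by
    ext z
    simp only [hT, hU, Set.mem_preimage, Set.mem_ofPred_eq, inner_graphMap hν,
      orthogonalProjectionOnto_graphMap, Set.mem_prod, Set.mem_univ, true_and, Set.mem_Iio]
    constructor <;> intro h <;> linarith
  have hTmem : ∀ y t, t < 0 → inner ℝ ν (T (y, t)) <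
      g ((ℝ ∙ ν)ᗮ.orthogonalProjectionOnto (T (y, t))) := by
    intro y t ht
    have : (y, t) ∈ T ⁻¹' U := by rw [hTU]; exact ⟨Set.mem_univ _, ht⟩
    exact this
  have hTgraph : ∀ y t, T (y, t) = graphMap ν (fun y => g y + t) y := fun _ _ => rfl
  have hTline : ∀ y t, T (y, t) = graphMap ν g y + t • ν := fun y t => by
    simp only [hT, graphMap, add_smul]
    abel
  have hgt : ∀ t, LipschitzWith K fun y => g y + t := fun t => by
    refine LipschitzWith.of_dist_le_mul fun x y => ?_
    rw [dist_add_right]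
    exact hg.dist_le_mul x y
  have hintU : ∀ u, IntegrableOn (fun x => fderiv ℝ h x u) U := by
    intro u
    refine IntegrableOn.of_forall_sdiff_eq_zero (s := U ∩ tsupport h) ?_ hUm ?_
    · refine Measure.integrableOn_of_bounded (M := C * ‖u‖)
        ((measure_mono Set.inter_subset_right).trans_lt (IsCompact.measure_lt_top hs)).ne
        (measurable_fderiv_apply_const ℝ h u).aestronglyMeasurable ?_
      filter_upwards [ae_restrict_mem (hUm.inter (isClosed_tsupport h).measurableSet)] with x hx
      exact (fderiv ℝ h x).le_of_opNorm_le (hC x hx.1) u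
    · intro x hx
      rw [fderiv_of_notMem_tsupport ℝ fun h => hx.2 ⟨hx.1, h⟩]
      rfl
  have hintT : ∀ u, Integrable (fun z => fderiv ℝ h (T z) u)
      (volume.prod (volume.restrict (Set.Iio 0))) := by
    intro u
    have := (hTmp.integrableOn_comp_preimage hTemb.measurableEmbedding).mpr (hintU u)
    rw [hTU, IntegrableOn, ← Measure.prod_restrict, Measure.restrict_univ] at this
    exact this
  have hwm : Measurable fun y => inner ℝ ν u - fderiv ℝ g y e :=
    measurable_const.sub (measurable_fderiv_apply_const ℝ g e)
  have hintw : Integrable (fun z : (ℝ ∙ ν)ᗮ × ℝ => (inner ℝ ν u - fderiv ℝ g z.1 e) *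
      fderiv ℝ h (T z) ν) (volume.prod (volume.restrict (Set.Iio 0))) := by
    refine (hintT ν).bdd_mul (c := ‖(inner ℝ ν u : ℝ)‖ + K * ‖e‖) ?_ ?_
    · exact (hwm.comp measurable_fst).aestronglyMeasurable
    · refine Filter.Eventually.of_forall fun y => (norm_sub_le _ _).trans ?_
      gcongr
      exact (fderiv ℝ g _).le_of_opNorm_le (norm_fderiv_le_of_lipschitz ℝ hg) e
  -- At the endpoint `t = 0` only continuity of `h` is available, and it suffices; at `-∞` the
  -- boundary term is zero by compact support.
  have hftc : ∀ y, IntegrableOn (fun t => fderiv ℝ h (T (y, t)) ν) (Set.Iio 0) →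
      ∫ t in Set.Iio 0, fderiv ℝ h (T (y, t)) ν = h (graphMap ν g y) := by
    intro y hy
    have hline : Topology.IsClosedEmbedding fun t : ℝ => graphMap ν g y + t • ν := by
      refine Function.LeftInverse.isClosedEmbedding
        (f := fun x => inner ℝ ν (x - graphMap ν g y)) (fun t => ?_) (by fun_prop) (by fun_prop)
      simp [inner_smul_right, hν]
    have hcs : HasCompactSupport fun t : ℝ => h (graphMap ν g y + t • ν) :=
      hs.comp_isClosedEmbedding hline
    have := integral_Iic_of_hasDerivAt_of_tendsto (a := 0) (m := 0)
      (f := fun t : ℝ => h (graphMap ν g y + t • ν))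
      (f' := fun t => fderiv ℝ h (T (y, t)) ν) ?_ ?_ ((integrableOn_Iic_iff_integrableOn_Iio (by finiteness)).mpr hy)
      ((hcs.is_zero_at_infty).mono_left atBot_le_cocompact)
    · rw [← integral_Iic_eq_integral_Iio, this]
      simp
    · refine ContinuousWithinAt.comp (t := {x | inner ℝ ν x ≤
        g ((ℝ ∙ ν)ᗮ.orthogonalProjectionOnto x)}) (hcont _ ?_) hline.continuous.continuousWithinAt
        fun t ht => ?_
      · rw [zero_smul, add_zero, Set.mem_ofPred_eq, inner_graphMap hν,
          orthogonalProjectionOnto_graphMap]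
      · rw [← hTline, Set.mem_ofPred_eq, hTgraph, inner_graphMap hν,
          orthogonalProjectionOnto_graphMap]
        have : t ≤ 0 := ht
        linarith
    · intro t ht
      have hfd := ((hd _ (hTmem y t ht)).differentiableAt one_ne_zero).hasFDerivAt
      rw [hTline] at hfd ⊢
      have hl : HasDerivAt (fun t : ℝ => graphMap ν g y + t • ν) ν t := by
        simpa using ((hasDerivAt_id t).smul_const ν).const_add (graphMap ν g y)
      exact hfd.comp_hasDerivAt t hl
  rw [← hTmp.setIntegral_preimage_emb hTemb.measurableEmbedding, hTU, ← Measure.prod_restrict,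
    Measure.restrict_univ, integral_prod_symm _ (hintT u)]
  -- Every slice `t < 0` lies in the open region where `h` is `C^1`, so tangential integration by
  -- parts applies to the graph of `g + t`. Since `g + t` and `g` have the same derivative, the
  -- weight comes out of the `t` integral.
  calc ∫ t in Set.Iio 0, ∫ y, fderiv ℝ h (T (y, t)) u
      = ∫ t in Set.Iio 0, ∫ y, (inner ℝ ν u - fderiv ℝ g y e) * fderiv ℝ h (T (y, t)) ν := by
        refine setIntegral_congr_fun measurableSet_Iio fun t ht => ?_
        have := integral_fderiv_graphMap hν (hgt t) hs (fun y => hd _ (hTmem y t ht))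
          (fun y => hC _ (hTmem y t ht)) u
        simp only [fderiv_add_const] at this
        exact this
    _ = ∫ y, ∫ t in Set.Iio 0, (inner ℝ ν u - fderiv ℝ g y e) * fderiv ℝ h (T (y, t)) ν :=
        (integral_integral_swap (f := fun y t => (inner ℝ ν u - fderiv ℝ g y e) *
          fderiv ℝ h (T (y, t)) ν) hintw).symm
    _ = _ := by
        refine integral_congr_ae ?_
        filter_upwards [(hintT ν).prod_right_ae] with y hy
        rw [integral_const_mul, hftc y hy]

end SubgraphDivergence

/-! ### The unit normal of a graph. -/

section GraphNormal

variable {E : Type*} [NormedAddCommGroup E] [InnerProductSpace ℝ E] [FiniteDimensional ℝ E]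

/-- The upward unit normal vector to the graph of `g` over the point `y`. -/
noncomputable def graphNormal (ν : E) (g : (ℝ ∙ ν)ᗮ → ℝ) (y : (ℝ ∙ ν)ᗮ) : E :=
  (areaDensity g y)⁻¹ •
    (ν - ((InnerProductSpace.toDual ℝ (ℝ ∙ ν)ᗮ).symm (fderiv ℝ g y) : (ℝ ∙ ν)ᗮ))

theorem areaDensity_pos {V : Type*} [NormedAddCommGroup V] [NormedSpace ℝ V] (g : V → ℝ) (y : V) :
    0 < areaDensity g y :=
  Real.sqrt_pos.mpr (by positivity)

/-- Up to the factor `(areaDensity g y)⁻¹`, this is the weight produced by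
`integral_fderiv_subgraph`. -/
theorem inner_graphNormal (ν : E) (g : (ℝ ∙ ν)ᗮ → ℝ) (y : (ℝ ∙ ν)ᗮ) (u : E) :
    inner ℝ (graphNormal ν g y) u = (areaDensity g y)⁻¹ *
      (inner ℝ ν u - fderiv ℝ g y ((ℝ ∙ ν)ᗮ.orthogonalProjectionOnto u)) := by
  set b := (InnerProductSpace.toDual ℝ (ℝ ∙ ν)ᗮ).symm (fderiv ℝ g y) with hb
  have h : fderiv ℝ g y ((ℝ ∙ ν)ᗮ.orthogonalProjectionOnto u) = inner ℝ (b : E) u := by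
    rw [← InnerProductSpace.toDual_symm_apply (𝕜 := ℝ), ← hb,
      ← Submodule.inner_orthogonalProjectionOnto_eq_of_mem_left]
  rw [h, graphNormal, ← hb, inner_smul_left, inner_sub_left]
  simp

theorem norm_graphNormal {ν : E} (hν : ‖ν‖ = 1) (g : (ℝ ∙ ν)ᗮ → ℝ) (y : (ℝ ∙ ν)ᗮ) :
    ‖graphNormal ν g y‖ = 1 := by
  have hpos := areaDensity_pos g y
  set b := (InnerProductSpace.toDual ℝ (ℝ ∙ ν)ᗮ).symm (fderiv ℝ g y) with hb
  have h : ‖ν - (b : E)‖ = areaDensity g y := by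
    rw [areaDensity, ← LinearIsometryEquiv.norm_map (InnerProductSpace.toDual ℝ (ℝ ∙ ν)ᗮ).symm,
      ← hb, eq_comm, Real.sqrt_eq_iff_mul_self_eq (by positivity) (norm_nonneg _), ← sq,
      @norm_sub_sq_real, inner_coe_orthogonal_singleton, hν, Submodule.coe_norm]
    ring
  rw [graphNormal, norm_smul, h, norm_inv, Real.norm_of_nonneg hpos.le, inv_mul_cancel₀ hpos.ne']

theorem measurable_graphNormal [MeasurableSpace E] [BorelSpace E] (ν : E) (g : (ℝ ∙ ν)ᗮ → ℝ) :
    Measurable (graphNormal ν g) := by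
  have h1 := measurable_areaDensity g
  have h2 := measurable_fderiv ℝ g
  have h3 : Continuous fun a : (ℝ ∙ ν)ᗮ →L[ℝ] ℝ =>
      ν - (((InnerProductSpace.toDual ℝ (ℝ ∙ ν)ᗮ).symm a : (ℝ ∙ ν)ᗮ) : E) := by fun_prop
  exact h1.inv.smul (h3.measurable.comp h2)

end GraphNormal

/-! ### Local geometry of the domain in a graph chart. -/

/-- Inside the ball of center `p` and radius `r`, the set `Ω` is the region below the graph of the
Lipschitz function `g` in the direction of `ν`. -/
structure IsGraphChart {ℓ : ℕ} (Ω : Set (EuclideanSpace ℝ (Fin ℓ)))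
    (p ν : EuclideanSpace ℝ (Fin ℓ)) (g : (ℝ ∙ ν)ᗮ → ℝ) (K : ℝ≥0) (r : ℝ) : Prop where
  norm_eq_one : ‖ν‖ = 1
  lipschitzWith : LipschitzWith K g
  pos : 0 < r
  mem_iff : ∀ x ∈ Metric.ball p r,
    x ∈ Ω ↔ inner ℝ ν x < g ((ℝ ∙ ν)ᗮ.orthogonalProjectionOnto x)

section Chart

variable {ℓ : ℕ} {Ω : Set (EuclideanSpace ℝ (Fin ℓ))}

theorem IsBoundedLipschitz.exists_chart (hΩ : IsBoundedLipschitz Ω)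
    {p : EuclideanSpace ℝ (Fin ℓ)} (hp : p ∈ frontier Ω) :
    ∃ ν g K r, IsGraphChart Ω p ν g K r := by
  obtain ⟨ν, g, K, r, h1, h2, h3, h4⟩ := hΩ.graph p hp
  exact ⟨ν, g, K, r, h1, h2, h3, h4⟩

variable {p ν : EuclideanSpace ℝ (Fin ℓ)} {g : (ℝ ∙ ν)ᗮ → ℝ} {K : ℝ≥0} {r : ℝ}

namespace IsGraphChart

theorem continuous_height (h : IsGraphChart Ω p ν g K r) :
    Continuous fun x => g ((ℝ ∙ ν)ᗮ.orthogonalProjectionOnto x) :=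
  h.lipschitzWith.continuous.comp (ContinuousLinearMap.continuous _)

theorem mem_closure_iff (h : IsGraphChart Ω p ν g K r) {x : EuclideanSpace ℝ (Fin ℓ)}
    (hx : x ∈ Metric.ball p r) :
    x ∈ closure Ω ↔ inner ℝ ν x ≤ g ((ℝ ∙ ν)ᗮ.orthogonalProjectionOnto x) := by
  have hball := Metric.isOpen_ball.mem_nhds hx
  constructor
  · intro hc
    by_contra! hlt
    have hev : ∀ᶠ z in 𝓝 x, z ∉ Ω := by
      filter_upwards [hball, (h.continuous_height.tendsto x).eventually_lt
        ((continuous_const.inner continuous_id).tendsto x) hlt] with z hz hz' hzΩ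
      exact lt_asymm ((h.mem_iff z hz).mp hzΩ) hz'
    exact (mem_closure_iff_frequently.mp hc) hev
  · intro hle
    have hlim : Filter.Tendsto (fun t : ℝ => x - t • ν) (𝓝[>] 0) (𝓝 x) := by
      have : Continuous fun t : ℝ => x - t • ν := by fun_prop
      have h0 := this.tendsto 0
      simp only [zero_smul, sub_zero] at h0
      exact h0.mono_left nhdsWithin_le_nhds
    refine mem_closure_of_tendsto hlim ?_
    filter_upwards [hlim.eventually hball, self_mem_nhdsWithin] with t ht ht0
    rw [h.mem_iff _ ht, map_sub, map_smul,
      Submodule.orthogonalProjectionOnto_orthogonalComplement_singleton_eq_zero, smul_zero,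
      sub_zero, inner_sub_right, inner_smul_right, real_inner_self_eq_norm_sq, h.norm_eq_one]
    have : 0 < t := ht0
    linarith

theorem mem_frontier_iff (h : IsGraphChart Ω p ν g K r) (ho : IsOpen Ω)
    {x : EuclideanSpace ℝ (Fin ℓ)} (hx : x ∈ Metric.ball p r) :
    x ∈ frontier Ω ↔ inner ℝ ν x = g ((ℝ ∙ ν)ᗮ.orthogonalProjectionOnto x) := by
  rw [ho.frontier_eq, Set.mem_sdiff, h.mem_closure_iff hx, h.mem_iff x hx, not_lt, le_antisymm_iff]

theorem frontier_inter_ball (h : IsGraphChart Ω p ν g K r) (ho : IsOpen Ω) :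
    frontier Ω ∩ Metric.ball p r = Set.range (graphMap ν g) ∩ Metric.ball p r := by
  ext x
  rw [Set.mem_inter_iff, Set.mem_inter_iff, and_congr_left_iff]
  intro hx
  rw [h.mem_frontier_iff ho hx, range_graphMap h.norm_eq_one]
  rfl

/-- The part near `p` of the open cone around `-ν` with opening determined by `K` lies in `Ω`. It is
convex with nonempty interior and has `p` in its closure, so derivatives within it are unique at
`p`. -/
theorem uniqueDiffWithinAt (h : IsGraphChart Ω p ν g K r) (hp : p ∈ frontier Ω)
    (ho : IsOpen Ω) : UniqueDiffWithinAt ℝ Ω p := by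
  have hp' := (h.mem_frontier_iff ho (Metric.mem_ball_self h.pos)).mp hp
  set P := (ℝ ∙ ν)ᗮ.orthogonalProjectionOnto with hP
  set C : Set (EuclideanSpace ℝ (Fin ℓ)) :=
    Metric.ball p r ∩ {z | inner ℝ ν (z - p) + K * ‖P (z - p)‖ < 0} with hC
  have hCo : IsOpen C := by
    refine Metric.isOpen_ball.inter (isOpen_lt ?_ continuous_const)
    fun_prop
  have hCsub : C ⊆ Ω := by
    rintro z ⟨hz, hz'⟩
    rw [h.mem_iff z hz]
    have h1 := h.lipschitzWith.dist_le_mul (P z) (P p)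
    rw [Real.dist_eq, dist_eq_norm, ← map_sub, abs_le] at h1
    rw [Set.mem_ofPred_eq, inner_sub_right] at hz'
    linarith [h1.1]
  have hconv : Convex ℝ C := by
    refine (convex_ball p r).inter ?_
    have hf : ConvexOn ℝ Set.univ fun z : EuclideanSpace ℝ (Fin ℓ) =>
        inner ℝ ν (z - p) + K * ‖P (z - p)‖ := by
      refine ⟨convex_univ, fun x _ y _ a b ha hb hab => ?_⟩
      have hsplit : a • x + b • y - p = a • (x - p) + b • (y - p) := by
        rw [smul_sub, smul_sub, sub_add_sub_comm, ← add_smul, hab, one_smul]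
      have hn := norm_add_le (a • P (x - p)) (b • P (y - p))
      rw [norm_smul, norm_smul, Real.norm_of_nonneg ha, Real.norm_of_nonneg hb] at hn
      simp only [hsplit, inner_add_right, inner_smul_right, map_add, map_smul, smul_eq_mul]
      nlinarith [mul_le_mul_of_nonneg_left hn K.2]
    simpa using hf.convex_lt 0
  have hlim : Filter.Tendsto (fun t : ℝ => p - t • ν) (𝓝[>] 0) (𝓝 p) := by
    have : Continuous fun t : ℝ => p - t • ν := by fun_prop
    have h0 := this.tendsto 0
    simp only [zero_smul, sub_zero] at h0
    exact h0.mono_left nhdsWithin_le_nhds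
  have hev : ∀ᶠ t : ℝ in 𝓝[>] 0, p - t • ν ∈ C := by
    filter_upwards [hlim.eventually (Metric.ball_mem_nhds p h.pos), self_mem_nhdsWithin]
      with t ht ht0
    refine ⟨ht, ?_⟩
    rw [Set.mem_ofPred_eq, sub_sub_cancel_left, map_neg, map_smul, hP,
      Submodule.orthogonalProjectionOnto_orthogonalComplement_singleton_eq_zero, inner_neg_right,
      inner_smul_right, real_inner_self_eq_norm_sq, h.norm_eq_one]
    have : 0 < t := ht0
    simpa using this
  refine (uniqueDiffWithinAt_convex hconv ?_ ?_).mono hCsub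
  · rw [hCo.interior_eq]
    obtain ⟨t, ht⟩ := hev.exists
    exact ⟨_, ht⟩
  · exact mem_closure_of_tendsto hlim hev

/-- Differentiability of `g` gives `⟨ν, x⟩ - g(Px) = areaDensity g y * ⟨n, x - s⟩ + o(‖x - s‖)`,
with `n` the graph normal. Inside the two cones the main term dominates, and its sign decides
membership in `Ω`. -/
theorem isOutwardUnitNormal_graphNormal (h : IsGraphChart Ω p ν g K r) {y : (ℝ ∙ ν)ᗮ}
    (hy : graphMap ν g y ∈ Metric.ball p r) (hd : DifferentiableAt ℝ g y) :
    IsOutwardUnitNormal Ω (graphMap ν g y) (graphNormal ν g y) := by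
  refine ⟨norm_graphNormal h.norm_eq_one g y, fun ε hε => ?_⟩
  set s := graphMap ν g y with hs
  set P := (ℝ ∙ ν)ᗮ.orthogonalProjectionOnto with hP
  have hPs : P s = y := orthogonalProjectionOnto_graphMap ν g y
  have hνs : inner ℝ ν s = g y := inner_graphMap h.norm_eq_one g y
  have hJ := areaDensity_pos g y
  have hJ1 : 1 ≤ areaDensity g y := Real.one_le_sqrt.mpr (by nlinarith [sq_nonneg ‖fderiv ℝ g y‖])
  have hcomp : HasFDerivAt (fun x => g (P x)) ((fderiv ℝ g y).comp P) s := by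
    have h1 := hd.hasFDerivAt
    rw [← hPs] at h1
    have := h1.comp s P.hasFDerivAt
    rwa [hPs] at this
  filter_upwards [Metric.isOpen_ball.mem_nhds hy, hcomp.isLittleO.def hε] with x hx hlo
  rw [hPs, ContinuousLinearMap.comp_apply, Real.norm_eq_abs, abs_le] at hlo
  rw [h.mem_iff x hx, inner_graphNormal, ← hP]
  -- Since the area element is at least `1`, the cone margin stays at least `ε‖x - s‖` after
  -- clearing the normalization and absorbs the linearization error.
  have hJn : ε * ‖x - s‖ ≤ areaDensity g y * (ε * ‖x - s‖) :=
    le_mul_of_one_le_left (by positivity) hJ1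
  have hsub : inner ℝ ν (x - s) = inner ℝ ν x - g y := by rw [inner_sub_right, hνs]
  constructor
  · intro hlt
    rw [inv_mul_lt_iff₀ hJ, hsub] at hlt
    linarith [hlo.1]
  · intro hlt
    rw [lt_inv_mul_iff₀ hJ, hsub] at hlt
    rw [not_lt]
    linarith [hlo.2]

end IsGraphChart

end Chart

/-! ### The surface measure and the outward normal. -/

section SurfaceMeasure

variable {ℓ : ℕ} {Ω : Set (EuclideanSpace ℝ (Fin ℓ))}

theorem IsOutwardUnitNormal.outwardNormal_eq {s ν : EuclideanSpace ℝ (Fin ℓ)}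
    (h : IsOutwardUnitNormal Ω s ν) : outwardNormal Ω s = ν := by
  have hex : ∃ ν, IsOutwardUnitNormal Ω s ν := ⟨ν, h⟩
  rw [outwardNormal, dif_pos hex]
  exact hex.choose_spec.unique h

theorem norm_outwardNormal_le (s : EuclideanSpace ℝ (Fin ℓ)) : ‖outwardNormal Ω s‖ ≤ 1 := by
  by_cases hex : ∃ ν, IsOutwardUnitNormal Ω s ν
  · obtain ⟨ν, h⟩ := hex
    rw [h.outwardNormal_eq, h.1]
  · rw [outwardNormal, dif_neg hex, norm_zero]
    exact zero_le_one

theorem IsBoundedLipschitz.isCompact_closure (hΩ : IsBoundedLipschitz Ω) :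
    IsCompact (closure Ω) :=
  hΩ.isBounded.isCompact_closure

theorem IsBoundedLipschitz.isCompact_frontier (hΩ : IsBoundedLipschitz Ω) :
    IsCompact (frontier Ω) :=
  hΩ.isCompact_closure.of_isClosed_subset isClosed_frontier frontier_subset_closure

/-- This makes derivatives within `closure Ω` well determined up to the boundary, so iterated
partials inherit `ContDiffOn` regularity. -/
theorem IsBoundedLipschitz.uniqueDiffOn_closure (hΩ : IsBoundedLipschitz Ω) :
    UniqueDiffOn ℝ (closure Ω) := by
  intro x hx
  by_cases hxΩ : x ∈ Ω
  · exact (hΩ.isOpen.uniqueDiffWithinAt hxΩ).mono subset_closure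
  · have hxf : x ∈ frontier Ω := by
      rw [hΩ.isOpen.frontier_eq]
      exact ⟨hx, hxΩ⟩
    obtain ⟨ν, g, K, r, h⟩ := hΩ.exists_chart hxf
    exact (h.uniqueDiffWithinAt hxf hΩ.isOpen).mono subset_closure

theorem finrank_orthogonal_singleton_euclideanSpace {ν : EuclideanSpace ℝ (Fin ℓ)}
    (hν : ‖ν‖ = 1) : Module.finrank ℝ (ℝ ∙ ν)ᗮ = ℓ - 1 := by
  have hne : ν ≠ 0 := by
    rintro rfl
    simp at hν
  have h := (ℝ ∙ ν).finrank_add_finrank_orthogonal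
  rw [finrank_span_singleton hne, finrank_euclideanSpace_fin] at h
  omega

variable {p ν : EuclideanSpace ℝ (Fin ℓ)} {g : (ℝ ∙ ν)ᗮ → ℝ} {K : ℝ≥0} {r : ℝ}

theorem IsGraphChart.surfaceMeasure_restrict_ball (h : IsGraphChart Ω p ν g K r)
    (ho : IsOpen Ω) :
    (surfaceMeasure Ω).restrict (Metric.ball p r) =
      ((volume.withDensity fun y => ENNReal.ofReal (areaDensity g y)).map
        (graphMap ν g)).restrict (Metric.ball p r) := by
  rw [← euclideanHausdorffMeasure_restrict_range_graphMap h.norm_eq_one h.lipschitzWith,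
    finrank_orthogonal_singleton_euclideanSpace h.norm_eq_one, surfaceMeasure,
    Measure.restrict_restrict Metric.isOpen_ball.measurableSet,
    Measure.restrict_restrict Metric.isOpen_ball.measurableSet, Set.inter_comm,
    h.frontier_inter_ball ho, Set.inter_comm]

theorem IsGraphChart.ae_isOutwardUnitNormal (h : IsGraphChart Ω p ν g K r) (ho : IsOpen Ω) :
    ∀ᵐ s ∂(surfaceMeasure Ω).restrict (Metric.ball p r),
      IsOutwardUnitNormal Ω s
        (graphNormal ν g ((ℝ ∙ ν)ᗮ.orthogonalProjectionOnto s)) := by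
  rw [h.surfaceMeasure_restrict_ball ho, ae_restrict_iff' Metric.isOpen_ball.measurableSet,
    (isClosedEmbedding_graphMap ν h.lipschitzWith.continuous).measurableEmbedding.ae_map_iff]
  have hae : ∀ᵐ y : (ℝ ∙ ν)ᗮ, DifferentiableAt ℝ g y := h.lipschitzWith.ae_differentiableAt
  filter_upwards [(withDensity_absolutelyContinuous volume _).ae_le hae] with y hy hb
  rw [orthogonalProjectionOnto_graphMap]
  exact h.isOutwardUnitNormal_graphNormal hb hy

theorem IsGraphChart.surfaceMeasure_ball_lt_top (h : IsGraphChart Ω p ν g K r)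
    (ho : IsOpen Ω) : surfaceMeasure Ω (Metric.ball p r) < ⊤ := by
  have hemb := isClosedEmbedding_graphMap ν h.lipschitzWith.continuous
  have hm : MeasurableSet (graphMap ν g ⁻¹' Metric.ball p r) :=
    hemb.continuous.measurable Metric.isOpen_ball.measurableSet
  rw [← Measure.restrict_apply_self, h.surfaceMeasure_restrict_ball ho, Measure.restrict_apply_self,
    Measure.map_apply hemb.continuous.measurable Metric.isOpen_ball.measurableSet,
    withDensity_apply _ hm]
  have hfin : volume (graphMap ν g ⁻¹' Metric.ball p r) < ⊤ :=
    (measure_mono (Set.preimage_mono Metric.ball_subset_closedBall)).trans_lt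
      (hemb.isCompact_preimage (isCompact_closedBall p r)).measure_lt_top
  refine (setLIntegral_lt_top_of_le_nnreal hfin.ne ⟨(√(1 + K ^ 2)).toNNReal, fun y _ => ?_⟩)
  refine ENNReal.ofReal_le_ofReal (Real.sqrt_le_sqrt ?_)
  gcongr
  exact norm_fderiv_le_of_lipschitz ℝ h.lipschitzWith

theorem IsBoundedLipschitz.surfaceMeasure_univ_lt_top (hΩ : IsBoundedLipschitz Ω) :
    surfaceMeasure Ω Set.univ < ⊤ := by
  have h : surfaceMeasure Ω (frontier Ω) < ⊤ := by
    refine hΩ.isCompact_frontier.induction_on (p := fun s => surfaceMeasure Ω s < ⊤) (by simp)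
      (fun s t hst ht => (measure_mono hst).trans_lt ht) (fun s t hs ht => ?_) fun x hx => ?_
    · exact (measure_union_le s t).trans_lt (ENNReal.add_lt_top.mpr ⟨hs, ht⟩)
    · obtain ⟨ν, g, K, r, h⟩ := hΩ.exists_chart hx
      exact ⟨_, mem_nhdsWithin_of_mem_nhds (Metric.ball_mem_nhds x h.pos),
        h.surfaceMeasure_ball_lt_top hΩ.isOpen⟩
  rwa [surfaceMeasure, Measure.restrict_apply_self, ← Measure.restrict_apply_univ] at h

theorem surfaceMeasure_restrict_frontier :
    (surfaceMeasure Ω).restrict (frontier Ω) = surfaceMeasure Ω := by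
  rw [surfaceMeasure, Measure.restrict_restrict isClosed_frontier.measurableSet, Set.inter_self]

theorem IsBoundedLipschitz.ae_exists_isOutwardUnitNormal (hΩ : IsBoundedLipschitz Ω) :
    ∀ᵐ s ∂surfaceMeasure Ω, IsOutwardUnitNormal Ω s (outwardNormal Ω s) := by
  rw [← surfaceMeasure_restrict_frontier]
  refine hΩ.isCompact_frontier.induction_on (p := fun t => ∀ᵐ s ∂(surfaceMeasure Ω).restrict t,
    IsOutwardUnitNormal Ω s (outwardNormal Ω s)) (by simp)
    (fun s t hst ht => ae_restrict_of_ae_restrict_of_subset hst ht) (fun s t hs ht => ?_)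
    fun x hx => ?_
  · exact (ae_restrict_union_iff _ _ _).mpr ⟨hs, ht⟩
  · obtain ⟨ν, g, K, r, h⟩ := hΩ.exists_chart hx
    refine ⟨_, mem_nhdsWithin_of_mem_nhds (Metric.ball_mem_nhds x h.pos), ?_⟩
    filter_upwards [h.ae_isOutwardUnitNormal hΩ.isOpen] with s hs
    rwa [hs.outwardNormal_eq]

/-- `outwardNormal` is defined by choice. Measurability comes from its almost everywhere agreement,
in each chart, with the measurable `graphNormal`, and finitely many charts cover the boundary. -/
theorem IsBoundedLipschitz.aemeasurable_outwardNormal (hΩ : IsBoundedLipschitz Ω) :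
    AEMeasurable (outwardNormal Ω) (surfaceMeasure Ω) := by
  rw [← surfaceMeasure_restrict_frontier]
  refine hΩ.isCompact_frontier.induction_on (p := fun t => AEMeasurable (outwardNormal Ω)
    ((surfaceMeasure Ω).restrict t)) (by simp)
    (fun s t hst ht => ht.mono_set hst) (fun s t hs ht => ?_) fun x hx => ?_
  · exact aemeasurable_union_iff.mpr ⟨hs, ht⟩
  · obtain ⟨ν, g, K, r, h⟩ := hΩ.exists_chart hx
    refine ⟨_, mem_nhdsWithin_of_mem_nhds (Metric.ball_mem_nhds x h.pos), _,
      (measurable_graphNormal ν g).comp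
        ((ℝ ∙ ν)ᗮ.orthogonalProjectionOnto (𝕜 := ℝ)).continuous.measurable, ?_⟩
    filter_upwards [h.ae_isOutwardUnitNormal hΩ.isOpen] with s hs
    exact hs.outwardNormal_eq

/-- Change of variables in a surface integral against the normal vector. -/
theorem IsGraphChart.integral_mul_inner_outwardNormal (h : IsGraphChart Ω p ν g K r)
    (ho : IsOpen Ω) {f : EuclideanSpace ℝ (Fin ℓ) → ℝ} (hf : tsupport f ⊆ Metric.ball p r)
    (u : EuclideanSpace ℝ (Fin ℓ)) :
    ∫ s, f s * inner ℝ (outwardNormal Ω s) u ∂surfaceMeasure Ω =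
      ∫ y, (inner ℝ ν u - fderiv ℝ g y ((ℝ ∙ ν)ᗮ.orthogonalProjectionOnto u)) *
        f (graphMap ν g y) := by
  set P := (ℝ ∙ ν)ᗮ.orthogonalProjectionOnto with hP
  have hf0 : ∀ s, s ∉ Metric.ball p r → f s = 0 := fun s hs =>
    image_eq_zero_of_notMem_tsupport fun h => hs (hf h)
  have h1 : ∫ s, f s * inner ℝ (outwardNormal Ω s) u ∂surfaceMeasure Ω =
      ∫ s in Metric.ball p r, f s * inner ℝ (outwardNormal Ω s) u ∂surfaceMeasure Ω := by
    refine (setIntegral_eq_integral_of_forall_compl_eq_zero fun s hs => ?_).symm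
    rw [hf0 s hs, zero_mul]
  have h2 : ∫ s in Metric.ball p r, f s * inner ℝ (outwardNormal Ω s) u ∂surfaceMeasure Ω =
      ∫ s in Metric.ball p r, f s * inner ℝ (graphNormal ν g (P s)) u ∂surfaceMeasure Ω := by
    refine integral_congr_ae ?_
    filter_upwards [h.ae_isOutwardUnitNormal ho] with s hs
    rw [hs.outwardNormal_eq]
  rw [h1, h2, h.surfaceMeasure_restrict_ball ho,
    setIntegral_eq_integral_of_forall_compl_eq_zero fun s hs => by rw [hf0 s hs, zero_mul],
    (isClosedEmbedding_graphMap ν h.lipschitzWith.continuous).measurableEmbedding.integral_map]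
  change ∫ y, _ ∂(volume.withDensity fun y => ((areaDensity g y).toNNReal : ENNReal)) = _
  rw [integral_withDensity_eq_integral_smul (measurable_areaDensity g).real_toNNReal]
  refine integral_congr_ae (Filter.Eventually.of_forall fun y => ?_)
  have hJ := areaDensity_pos g y
  simp only [hP, orthogonalProjectionOnto_graphMap, inner_graphNormal, NNReal.smul_def,
    Real.coe_toNNReal _ hJ.le, smul_eq_mul]
  -- The density from the area formula cancels the inverse in `inner_graphNormal`.
  field_simp

end SurfaceMeasure

/-! ### The divergence theorem on bounded Lipschitz domains. -/

section GaussGreen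

variable {ℓ : ℕ} {Ω : Set (EuclideanSpace ℝ (Fin ℓ))}

theorem ContDiffOn.contDiffAt_of_closure {h : EuclideanSpace ℝ (Fin ℓ) → ℝ}
    (hh : ContDiffOn ℝ 1 h (closure Ω)) (ho : IsOpen Ω) {x : EuclideanSpace ℝ (Fin ℓ)}
    (hx : x ∈ Ω) : ContDiffAt ℝ 1 h x :=
  hh.contDiffAt (Filter.mem_of_superset (ho.mem_nhds hx) subset_closure)

theorem fderivWithin_closure_eq_fderiv {F : Type*} [NormedAddCommGroup F] [NormedSpace ℝ F]
    {h : EuclideanSpace ℝ (Fin ℓ) → F} (ho : IsOpen Ω) {x : EuclideanSpace ℝ (Fin ℓ)}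
    (hx : x ∈ Ω) : fderivWithin ℝ h (closure Ω) x = fderiv ℝ h x :=
  fderivWithin_of_mem_nhds (Filter.mem_of_superset (ho.mem_nhds hx) subset_closure)

theorem IsBoundedLipschitz.exists_norm_fderiv_le (hΩ : IsBoundedLipschitz Ω)
    {h : EuclideanSpace ℝ (Fin ℓ) → ℝ} (hh : ContDiffOn ℝ 1 h (closure Ω)) :
    ∃ C, 0 ≤ C ∧ ∀ x ∈ Ω, ‖fderiv ℝ h x‖ ≤ C := by
  obtain ⟨C, hC⟩ := hΩ.isCompact_closure.exists_bound_of_continuousOn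
    (hh.continuousOn_fderivWithin hΩ.uniqueDiffOn_closure le_rfl)
  refine ⟨max C 0, le_max_right _ _, fun x hx => ?_⟩
  rw [← fderivWithin_closure_eq_fderiv hΩ.isOpen hx]
  exact (hC x (subset_closure hx)).trans (le_max_left _ _)

theorem IsBoundedLipschitz.integrableOn_of_continuousOn_closure (hΩ : IsBoundedLipschitz Ω)
    {f : EuclideanSpace ℝ (Fin ℓ) → ℝ} (hf : ContinuousOn f (closure Ω)) : IntegrableOn f Ω :=
  (hf.integrableOn_compact hΩ.isCompact_closure).mono_set subset_closure

theorem IsBoundedLipschitz.integrableOn_fderiv (hΩ : IsBoundedLipschitz Ω)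
    {h : EuclideanSpace ℝ (Fin ℓ) → ℝ} (hh : ContDiffOn ℝ 1 h (closure Ω))
    (u : EuclideanSpace ℝ (Fin ℓ)) : IntegrableOn (fun x => fderiv ℝ h x u) Ω := by
  have hc := (hh.continuousOn_fderivWithin hΩ.uniqueDiffOn_closure le_rfl).clm_apply
    (continuousOn_const (c := u))
  refine (hΩ.integrableOn_of_continuousOn_closure hc).congr_fun (fun x hx => ?_)
    hΩ.isOpen.measurableSet
  simp only [fderivWithin_closure_eq_fderiv hΩ.isOpen hx]

theorem IsBoundedLipschitz.isFiniteMeasure_surfaceMeasure (hΩ : IsBoundedLipschitz Ω) :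
    IsFiniteMeasure (surfaceMeasure Ω) :=
  ⟨hΩ.surfaceMeasure_univ_lt_top⟩

theorem IsBoundedLipschitz.integrable_of_continuousOn_closure (hΩ : IsBoundedLipschitz Ω)
    {f : EuclideanSpace ℝ (Fin ℓ) → ℝ} (hf : ContinuousOn f (closure Ω)) :
    Integrable f (surfaceMeasure Ω) := by
  have := hΩ.isFiniteMeasure_surfaceMeasure
  rw [← surfaceMeasure_restrict_frontier]
  exact (hf.mono frontier_subset_closure).integrableOn_compact hΩ.isCompact_frontier

theorem IsBoundedLipschitz.integrable_mul_inner_outwardNormal (hΩ : IsBoundedLipschitz Ω)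
    {f : EuclideanSpace ℝ (Fin ℓ) → ℝ} (hf : ContinuousOn f (closure Ω))
    (u : EuclideanSpace ℝ (Fin ℓ)) :
    Integrable (fun s => f s * inner ℝ (outwardNormal Ω s) u) (surfaceMeasure Ω) := by
  refine (hΩ.integrable_of_continuousOn_closure hf).mul_bdd (c := ‖u‖) ?_ ?_
  · exact (hΩ.aemeasurable_outwardNormal.inner aemeasurable_const).aestronglyMeasurable
  · refine Filter.Eventually.of_forall fun s => (norm_inner_le_norm _ _).trans ?_
    exact mul_le_of_le_one_left (norm_nonneg _) (norm_outwardNormal_le s)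

/-- The divergence theorem for functions supported in a graph chart. -/
theorem IsGraphChart.integral_fderiv_eq (hΩ : IsBoundedLipschitz Ω)
    {p ν : EuclideanSpace ℝ (Fin ℓ)} {g : (ℝ ∙ ν)ᗮ → ℝ} {K : ℝ≥0} {r : ℝ}
    (hc : IsGraphChart Ω p ν g K r) {h : EuclideanSpace ℝ (Fin ℓ) → ℝ}
    (hh : ContDiffOn ℝ 1 h (closure Ω)) (hs : tsupport h ⊆ Metric.ball p r)
    (u : EuclideanSpace ℝ (Fin ℓ)) :
    ∫ x in Ω, fderiv ℝ h x u =
      ∫ s, h s * inner ℝ (outwardNormal Ω s) u ∂surfaceMeasure Ω := by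
  set P := (ℝ ∙ ν)ᗮ.orthogonalProjectionOnto (𝕜 := ℝ) with hP
  have hcs : HasCompactSupport h :=
    Metric.isCompact_of_isClosed_isBounded (isClosed_tsupport h) (Metric.isBounded_ball.subset hs)
  obtain ⟨C, hC0, hC⟩ := hΩ.exists_norm_fderiv_le hh
  -- On the support of `h`, which lies in the ball, `Ω` and the subgraph coincide; off the support
  -- `h` is locally zero. This splits every verification below into two cases.
  have hdom : ∀ x, inner ℝ ν x < g (P x) → x ∈ tsupport h → x ∈ Ω := fun x hx hxs =>
    (hc.mem_iff x (hs hxs)).mpr hx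
  have hsub := integral_fderiv_subgraph hc.norm_eq_one hc.lipschitzWith hcs ?_ ?_ (C := C) ?_ u
  · rw [hc.integral_mul_inner_outwardNormal hΩ.isOpen hs, ← hsub]
    have hUm : MeasurableSet {x | inner ℝ ν x < g (P x)} :=
      (isOpen_lt (by fun_prop) hc.continuous_height).measurableSet
    have hz : ∀ x, x ∉ tsupport h → fderiv ℝ h x u = 0 := fun x hx => by
      rw [fderiv_of_notMem_tsupport ℝ hx]
      rfl
    rw [← integral_indicator hΩ.isOpen.measurableSet, ← integral_indicator hUm]
    congr 1
    ext x
    by_cases hx : x ∈ tsupport h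
    · have : x ∈ Ω ↔ x ∈ {x | inner ℝ ν x < g (P x)} := hc.mem_iff x (hs hx)
      by_cases hxΩ : x ∈ Ω
      · rw [Set.indicator_of_mem hxΩ, Set.indicator_of_mem (this.mp hxΩ)]
      · rw [Set.indicator_of_notMem hxΩ, Set.indicator_of_notMem fun h => hxΩ (this.mpr h)]
    · simp only [Set.indicator, hz x hx, ite_self]
  · intro x hx
    by_cases hxs : x ∈ tsupport h
    · have hball := hs hxs
      have hcl := (hc.mem_closure_iff hball).mpr hx
      refine (hh.continuousOn x hcl).mono_of_mem_nhdsWithin ?_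
      rw [mem_nhdsWithin]
      exact ⟨_, Metric.isOpen_ball, hball, fun z hz => (hc.mem_closure_iff hz.1).mpr hz.2⟩
    · exact ((continuousAt_const (y := (0 : ℝ))).congr
        (notMem_tsupport_iff_eventuallyEq.mp hxs).symm).continuousWithinAt
  · intro x hx
    by_cases hxs : x ∈ tsupport h
    · exact hh.contDiffAt_of_closure hΩ.isOpen (hdom x hx hxs)
    · exact contDiffAt_const.congr_of_eventuallyEq (notMem_tsupport_iff_eventuallyEq.mp hxs)
  · intro x hx
    by_cases hxs : x ∈ tsupport h
    · exact hC x (hdom x hx hxs)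
    · rw [fderiv_of_notMem_tsupport ℝ hxs, norm_zero]
      exact hC0

/-- Both sides vanish: `h` is globally `C^1` with compact support, and it is zero on the boundary
because `Ω` is open. -/
theorem IsBoundedLipschitz.integral_fderiv_eq_of_tsupport_subset (hΩ : IsBoundedLipschitz Ω)
    {h : EuclideanSpace ℝ (Fin ℓ) → ℝ} (hh : ContDiffOn ℝ 1 h (closure Ω))
    (hs : tsupport h ⊆ Ω) (u : EuclideanSpace ℝ (Fin ℓ)) :
    ∫ x in Ω, fderiv ℝ h x u =
      ∫ s, h s * inner ℝ (outwardNormal Ω s) u ∂surfaceMeasure Ω := by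
  have hcs : HasCompactSupport h :=
    Metric.isCompact_of_isClosed_isBounded (isClosed_tsupport h) (hΩ.isBounded.subset hs)
  have hC1 : ContDiff ℝ 1 h := contDiff_iff_contDiffAt.mpr fun x => by
    by_cases hx : x ∈ tsupport h
    · exact hh.contDiffAt_of_closure hΩ.isOpen (hs hx)
    · exact contDiffAt_const.congr_of_eventuallyEq (notMem_tsupport_iff_eventuallyEq.mp hx)
  obtain ⟨K, hK⟩ := hC1.lipschitzWith_of_hasCompactSupport hcs one_ne_zero
  have h0 := hK.integral_lineDeriv_eq_zero (μ := volume) hcs u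
  have h1 : ∫ x in Ω, fderiv ℝ h x u = 0 := by
    rw [setIntegral_eq_integral_of_forall_compl_eq_zero, ← h0]
    · refine integral_congr_ae (Filter.Eventually.of_forall fun x => ?_)
      exact ((hC1.differentiable one_ne_zero) x).lineDeriv_eq_fderiv.symm
    · intro x hx
      rw [fderiv_of_notMem_tsupport ℝ fun hx' => hx (hs hx')]
      rfl
  have h2 : ∫ s, h s * inner ℝ (outwardNormal Ω s) u ∂surfaceMeasure Ω = 0 := by
    rw [surfaceMeasure]
    refine setIntegral_eq_zero_of_forall_eq_zero fun s hsf => ?_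
    rw [hΩ.isOpen.frontier_eq] at hsf
    rw [image_eq_zero_of_notMem_tsupport fun hx' => hsf.2 (hs hx'), zero_mul]
  rw [h1, h2]

open scoped Manifold ContDiff in
/-- The divergence theorem on bounded Lipschitz domains, for functions that are `C^1` up to the
boundary. -/
theorem IsBoundedLipschitz.integral_fderiv_eq (hΩ : IsBoundedLipschitz Ω)
    {f : EuclideanSpace ℝ (Fin ℓ) → ℝ} (hf : ContDiffOn ℝ 1 f (closure Ω))
    (u : EuclideanSpace ℝ (Fin ℓ)) :
    ∫ x in Ω, fderiv ℝ f x u =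
      ∫ s, f s * inner ℝ (outwardNormal Ω s) u ∂surfaceMeasure Ω := by
  -- Every point of the closure has a neighbourhood, `Ω` itself or a chart ball, in which the
  -- formula holds for functions supported there.
  have hloc : ∀ p : closure Ω, ∃ U : Set (EuclideanSpace ℝ (Fin ℓ)), IsOpen U ∧ ↑p ∈ U ∧
      ∀ h : EuclideanSpace ℝ (Fin ℓ) → ℝ, ContDiffOn ℝ 1 h (closure Ω) → tsupport h ⊆ U →
        ∫ x in Ω, fderiv ℝ h x u =
          ∫ s, h s * inner ℝ (outwardNormal Ω s) u ∂surfaceMeasure Ω := by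
    rintro ⟨p, hp⟩
    by_cases hpΩ : p ∈ Ω
    · exact ⟨Ω, hΩ.isOpen, hpΩ, fun h hh hs => hΩ.integral_fderiv_eq_of_tsupport_subset hh hs u⟩
    · have hpf : p ∈ frontier Ω := by
        rw [hΩ.isOpen.frontier_eq]
        exact ⟨hp, hpΩ⟩
      obtain ⟨ν, g, K, r, hc⟩ := hΩ.exists_chart hpf
      exact ⟨_, Metric.isOpen_ball, Metric.mem_ball_self hc.pos,
        fun h hh hs => hc.integral_fderiv_eq hΩ hh hs u⟩
  choose U hUo hUp hU using hloc
  obtain ⟨t, ht⟩ := hΩ.isCompact_closure.elim_finite_subcover U hUo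
    fun x hx => Set.mem_iUnion.mpr ⟨⟨x, hx⟩, hUp _⟩
  obtain ⟨φ, hφ⟩ := SmoothPartitionOfUnity.exists_isSubordinate
    𝓘(ℝ, EuclideanSpace ℝ (Fin ℓ)) isClosed_closure (fun i : t => U i) (fun i => hUo i)
    (by rwa [Set.iUnion_subtype])
  have hsum : ∀ x ∈ closure Ω, ∑ i : t, φ i x * f x = f x := fun x hx => by
    rw [← Finset.sum_mul, ← finsum_eq_sum_of_fintype, φ.sum_eq_one hx, one_mul]
  have hC1 : ∀ i, ContDiffOn ℝ 1 (fun x => φ i x * f x) (closure Ω) := fun i =>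
    (((φ i).contMDiff.contDiff.of_le (by simp)).contDiffOn).mul hf
  have hsupp : ∀ i : t, tsupport (fun x => φ i x * f x) ⊆ U i := fun i =>
    (closure_mono (Function.support_mul_subset_left (φ i) f)).trans (hφ i)
  calc ∫ x in Ω, fderiv ℝ f x u
      = ∫ x in Ω, ∑ i : t, fderiv ℝ (fun x => φ i x * f x) x u := by
        refine setIntegral_congr_fun hΩ.isOpen.measurableSet fun x hx => ?_
        -- The partition sums to `1` only on the closure; openness of `Ω` makes the identity hold
        -- near `x`, so it can be differentiated.
        have hev : f =ᶠ[𝓝 x] fun x => ∑ i : t, φ i x * f x := by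
          filter_upwards [hΩ.isOpen.mem_nhds hx] with z hz
          exact (hsum z (subset_closure hz)).symm
        have hd : ∀ i ∈ Finset.univ, DifferentiableAt ℝ (fun x => φ i x * f x) x := fun i _ =>
          ((hC1 i).contDiffAt_of_closure hΩ.isOpen hx).differentiableAt one_ne_zero
        change fderiv ℝ f x u = _
        rw [hev.fderiv_eq, fderiv_fun_sum hd, _root_.sum_apply]
    _ = ∑ i : t, ∫ s, φ i s * f s * inner ℝ (outwardNormal Ω s) u ∂surfaceMeasure Ω := by
        rw [integral_finsetSum _ fun i _ => hΩ.integrableOn_fderiv (hC1 i) u]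
        exact Finset.sum_congr rfl fun i _ => hU i _ (hC1 i) (hsupp i)
    _ = ∫ s, f s * inner ℝ (outwardNormal Ω s) u ∂surfaceMeasure Ω := by
        rw [← integral_finsetSum _ fun i _ =>
          hΩ.integrable_mul_inner_outwardNormal (hC1 i).continuousOn u]
        refine setIntegral_congr_fun isClosed_frontier.measurableSet fun s hs => ?_
        change ∑ i : t, φ i s * f s * inner ℝ (outwardNormal Ω s) u = _
        rw [← Finset.sum_mul, hsum s (frontier_subset_closure hs)]

end GaussGreen

/-! ### Regrouping the triangular sum. -/

section Sums

theorem Finset.sum_Icc_one_eq_sum_range {M : Type*} [AddCommMonoid M] (f : ℕ → M) (n : ℕ) :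
    ∑ j ∈ Finset.Icc 1 n, f j = ∑ j ∈ Finset.range n, f (j + 1) := by
  rw [Finset.range_eq_Ico, Finset.sum_Ico_add' f 0 n 1]
  rfl

/-- The substitution `r = i - j`, `c = j - 1` turns the triangle into `r + c + 1 ≤ N`. Splitting off
`r = 0` and `c = 0`, where the constraint is automatic, gives the four blocks of the boundary
matrix. -/
theorem sum_triangle_eq_sum_blocks (H : ℕ → ℕ → ℝ) {N : ℕ} (hN : 1 ≤ N) :
    ∑ i ∈ Finset.Icc 1 N, ∑ j ∈ Finset.Icc 1 i, (-1 : ℝ) ^ (j - 1) * H (i - j) (j - 1) =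
      H 0 0 + ∑ c ∈ Finset.range (N - 1), (-1 : ℝ) ^ (c + 1) * H 0 (c + 1) +
        (∑ r ∈ Finset.range (N - 1), H (r + 1) 0 +
          ∑ r ∈ Finset.range (N - 1), ∑ c ∈ Finset.range (N - 1),
            if r + c + 3 ≤ N then (-1 : ℝ) ^ (c + 1) * H (r + 1) (c + 1) else 0) := by
  obtain ⟨n, rfl⟩ : ∃ n, N = n + 1 := ⟨N - 1, by omega⟩
  have h1 : ∑ i ∈ Finset.Icc 1 (n + 1), ∑ j ∈ Finset.Icc 1 i,
      (-1 : ℝ) ^ (j - 1) * H (i - j) (j - 1) =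
      ∑ r ∈ Finset.range (n + 1), ∑ c ∈ Finset.range (n + 1),
        if r + c + 1 ≤ n + 1 then (-1 : ℝ) ^ c * H r c else 0 := by
    rw [← Finset.sum_product', Finset.sum_sigma', ← Finset.sum_filter]
    refine Finset.sum_bij' (fun x _ => (x.1 - x.2, x.2 - 1)) (fun y _ => ⟨y.1 + y.2 + 1, y.2 + 1⟩)
      ?_ ?_ ?_ ?_ ?_
    · rintro ⟨i, j⟩ h
      simp only [Finset.mem_sigma, Finset.mem_Icc, Finset.mem_filter, Finset.mem_product,
        Finset.mem_range] at h ⊢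
      omega
    · rintro ⟨r, c⟩ h
      simp only [Finset.mem_sigma, Finset.mem_Icc, Finset.mem_filter, Finset.mem_product,
        Finset.mem_range] at h ⊢
      omega
    · rintro ⟨i, j⟩ h
      simp only [Finset.mem_sigma, Finset.mem_Icc] at h
      simp only [Sigma.mk.injEq, heq_eq_eq]
      omega
    · rintro ⟨r, c⟩ h
      simp only [Prod.mk.injEq]
      omega
    · rintro ⟨i, j⟩ h
      rfl
  rw [h1, Finset.sum_range_succ', Finset.sum_range_succ']
  simp_rw [Finset.sum_range_succ' _ n]
  rw [Finset.sum_add_distrib, Nat.add_sub_cancel]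
  have h2 : ∀ c ∈ Finset.range n, (if 0 + (c + 1) + 1 ≤ n + 1 then
      (-1 : ℝ) ^ (c + 1) * H 0 (c + 1) else 0) = (-1 : ℝ) ^ (c + 1) * H 0 (c + 1) :=
    fun c hc => if_pos (by have := Finset.mem_range.mp hc; omega)
  have h3 : ∀ r ∈ Finset.range n, (if r + 1 + 0 + 1 ≤ n + 1 then
      (-1 : ℝ) ^ 0 * H (r + 1) 0 else 0) = H (r + 1) 0 :=
    fun r hr => by
      rw [if_pos (by have := Finset.mem_range.mp hr; omega), pow_zero, one_mul]
  rw [Finset.sum_congr rfl h2, Finset.sum_congr rfl h3, if_pos (by omega), pow_zero, one_mul]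
  have h4 : ∀ r c, (r + 1 + (c + 1) + 1 ≤ n + 1) = (r + c + 3 ≤ n + 1) := fun r c =>
    propext (by omega)
  simp_rw [h4]
  ring

end Sums

/-! ### The quadratic expression of the boundary matrix. -/

section BoundaryMatrix

variable {ℓ m n : ℕ} (P : Fin ℓ → ℕ → Matrix (Fin m) (Fin n) ℝ) (ν : EuclideanSpace ℝ (Fin ℓ))

theorem dotProduct_blockP_mulVec (a : Fin n → ℝ) (b : Fin m → ℝ) :
    a ⬝ᵥ (blockP P ν *ᵥ b) = ∑ k, a ⬝ᵥ ((ν k • (P k 1)ᵀ) *ᵥ b) := by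
  rw [blockP, Matrix.sum_mulVec, dotProduct_sum]

theorem dotProduct_firstRow_mulVec {N : ℕ} (a : Fin n → ℝ)
    (b : Fin ℓ → ℕ → Fin m → ℝ) :
    a ⬝ᵥ ((Matrix.of fun (a : Fin n) (c : Fin (N - 1) × Fin ℓ × Fin m) =>
        (-1 : ℝ) ^ (c.1.1 + 1) * blockW P ν (c.1.1 + 2) a c.2) *ᵥ
          fun q => b q.2.1 (q.1 + 1) q.2.2) =
      ∑ k, ∑ c ∈ Finset.range (N - 1),
        (-1 : ℝ) ^ (c + 1) * (a ⬝ᵥ ((ν k • (P k (c + 2))ᵀ) *ᵥ b k (c + 1))) := by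
  simp_rw [← Fin.sum_univ_eq_sum_range (fun c => (-1 : ℝ) ^ (c + 1) *
    (a ⬝ᵥ ((ν _ • (P _ (c + 2))ᵀ) *ᵥ b _ (c + 1)))) (N - 1)]
  rw [Finset.sum_comm]
  simp only [dotProduct, mulVec, Matrix.of_apply, blockW, Fintype.sum_prod_type, Finset.mul_sum]
  rw [Finset.sum_comm]
  refine Finset.sum_congr rfl fun c _ => ?_
  rw [Finset.sum_comm]
  refine Finset.sum_congr rfl fun k _ => Finset.sum_congr rfl fun i _ =>
    Finset.sum_congr rfl fun j _ => ?_
  ring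

theorem dotProduct_firstColumn_mulVec {N : ℕ} (a : Fin ℓ → ℕ → Fin n → ℝ) (b : Fin m → ℝ) :
    (fun q : Fin (N - 1) × Fin ℓ × Fin n => a q.2.1 (q.1 + 1) q.2.2) ⬝ᵥ
        ((Matrix.of fun (r : Fin (N - 1) × Fin ℓ × Fin n) (b : Fin m) =>
          blockV P ν (r.1.1 + 2) r.2 b) *ᵥ b) =
      ∑ k, ∑ r ∈ Finset.range (N - 1), a k (r + 1) ⬝ᵥ ((ν k • (P k (r + 2))ᵀ) *ᵥ b) := by
  simp_rw [← Fin.sum_univ_eq_sum_range (fun r => a _ (r + 1) ⬝ᵥ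
    ((ν _ • (P _ (r + 2))ᵀ) *ᵥ b)) (N - 1)]
  rw [Finset.sum_comm]
  simp only [dotProduct, mulVec, Matrix.of_apply, blockV, Fintype.sum_prod_type]

theorem dotProduct_lowerRight_mulVec {N : ℕ} (a : Fin ℓ → ℕ → Fin n → ℝ)
    (b : Fin ℓ → ℕ → Fin m → ℝ) :
    (fun q : Fin (N - 1) × Fin ℓ × Fin n => a q.2.1 (q.1 + 1) q.2.2) ⬝ᵥ
        ((Matrix.of fun (r : Fin (N - 1) × Fin ℓ × Fin n) (c : Fin (N - 1) × Fin ℓ × Fin m) =>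
          if r.1.1 + c.1.1 + 3 ≤ N then
            (-1 : ℝ) ^ (c.1.1 + 1) * blockΛ P ν (r.1.1 + c.1.1 + 3) r.2 c.2
          else 0) *ᵥ fun q => b q.2.1 (q.1 + 1) q.2.2) =
      ∑ k, ∑ r ∈ Finset.range (N - 1), ∑ c ∈ Finset.range (N - 1),
        if r + c + 3 ≤ N then
          (-1 : ℝ) ^ (c + 1) * (a k (r + 1) ⬝ᵥ ((ν k • (P k (r + c + 3))ᵀ) *ᵥ b k (c + 1)))
        else 0 := by
  simp_rw [Finset.sum_range]
  rw [Finset.sum_comm]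
  simp only [dotProduct, mulVec, Matrix.of_apply, blockΛ, Fintype.sum_prod_type]
  refine Finset.sum_congr rfl fun r _ => Finset.sum_congr rfl fun k _ => ?_
  simp_rw [Finset.mul_sum]
  rw [Finset.sum_comm]
  refine Finset.sum_congr rfl fun c _ => ?_
  by_cases hrc : r.1 + c.1 + 3 ≤ N
  · simp only [if_pos hrc]
    refine Finset.sum_congr rfl fun i _ => ?_
    -- `Λ` is block diagonal, so derivatives in different directions never pair.
    rw [Finset.sum_eq_single k]
    · refine Finset.sum_congr rfl fun j _ => ?_
      rw [if_pos rfl]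
      ring
    · intro k' _ hk'
      refine Finset.sum_eq_zero fun j _ => ?_
      rw [if_neg (Ne.symm hk')]
      ring
    · simp
  · simp [if_neg hrc]

/-- The coefficient of the orders `(p, q)` is `P_k(p + q + 1)`, which depends only on `p + q`; hence
the Hankel pattern. The order zero entries occur once in the stacked vectors and are shared by all
directions `k`, which is the role of `ha` and `hb`. -/
theorem sumElim_dotProduct_boundaryMatrix_mulVec {N : ℕ} (hN : 1 ≤ N) {a₀ : Fin n → ℝ}
    {b₀ : Fin m → ℝ} {a : Fin ℓ → ℕ → Fin n → ℝ} {b : Fin ℓ → ℕ → Fin m → ℝ}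
    (ha : ∀ k, a k 0 = a₀) (hb : ∀ k, b k 0 = b₀) :
    (Sum.elim a₀ fun q => a q.2.1 (q.1 + 1) q.2.2 : StackIdx ℓ N n → ℝ) ⬝ᵥ
        (boundaryMatrix P ν N *ᵥ Sum.elim b₀ fun q => b q.2.1 (q.1 + 1) q.2.2) =
      ∑ k : Fin ℓ, ∑ i ∈ Finset.Icc 1 N, ∑ j ∈ Finset.Icc 1 i,
        (-1 : ℝ) ^ (j - 1) * (a k (i - j) ⬝ᵥ ((ν k • (P k i)ᵀ) *ᵥ b k (j - 1))) := by
  have h : ∀ k : Fin ℓ, ∑ i ∈ Finset.Icc 1 N, ∑ j ∈ Finset.Icc 1 i,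
      (-1 : ℝ) ^ (j - 1) * (a k (i - j) ⬝ᵥ ((ν k • (P k i)ᵀ) *ᵥ b k (j - 1))) = _ := fun k => by
    refine Eq.trans ?_ (sum_triangle_eq_sum_blocks
      (fun p q => a k p ⬝ᵥ ((ν k • (P k (p + q + 1))ᵀ) *ᵥ b k q)) hN)
    refine Finset.sum_congr rfl fun i _ => Finset.sum_congr rfl fun j hj => ?_
    have hij : i - j + (j - 1) + 1 = i := by
      have := Finset.mem_Icc.mp hj
      omega
    rw [hij]
  rw [Finset.sum_congr rfl fun k _ => h k, boundaryMatrix, Matrix.fromBlocks_mulVec,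
    sumElim_dotProduct_sumElim, dotProduct_add, dotProduct_add]
  have e1 : (Sum.elim b₀ fun q => b q.2.1 (q.1 + 1) q.2.2 : StackIdx ℓ N m → ℝ) ∘ Sum.inl = b₀ :=
    Sum.elim_comp_inl _ _
  have e2 : (Sum.elim b₀ fun q => b q.2.1 (q.1 + 1) q.2.2 : StackIdx ℓ N m → ℝ) ∘ Sum.inr =
    fun q => b q.2.1 (q.1 + 1) q.2.2 := Sum.elim_comp_inr _ _
  rw [e1, e2, dotProduct_blockP_mulVec, dotProduct_firstRow_mulVec, dotProduct_firstColumn_mulVec,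
    dotProduct_lowerRight_mulVec]
  simp only [Finset.sum_add_distrib, ha, hb, zero_add, add_zero]
  have h3 : ∀ r c, r + 1 + (c + 1) + 1 = r + c + 3 := fun r c => by ring
  simp only [h3, add_assoc, zero_add, Nat.reduceAdd]

end BoundaryMatrix

/-! ### The Lagrange identity. -/

section Green

variable {ℓ : ℕ}

theorem ContDiffOn.pderivOn {d : ℕ} {S : Set (EuclideanSpace ℝ (Fin ℓ))}
    (hS : UniqueDiffOn ℝ S) (k : Fin ℓ) {f : EuclideanSpace ℝ (Fin ℓ) → Fin d → ℝ} {N : ℕ}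
    (hf : ContDiffOn ℝ N f S) {i j : ℕ} (hij : i + j ≤ N) :
    ContDiffOn ℝ j (pderivOn S k i f) S := by
  induction i generalizing j with
  | zero => exact hf.of_le (by exact_mod_cast (by omega : j ≤ N))
  | succ i ih =>
    have h : ContDiffOn ℝ (j + 1 : ℕ) (_root_.pderivOn S k i f) S := ih (by omega)
    exact (h.fderivWithin hS (by norm_cast)).clm_apply contDiffOn_const

theorem ContDiffOn.dotProduct_mulVec {X : Type*} [NormedAddCommGroup X] [NormedSpace ℝ X]
    {n m : ℕ} {S : Set X} {a : X → Fin n → ℝ} {b : X → Fin m → ℝ} (ha : ContDiffOn ℝ 1 a S)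
    (hb : ContDiffOn ℝ 1 b S) (M : Matrix (Fin n) (Fin m) ℝ) :
    ContDiffOn ℝ 1 (fun x => a x ⬝ᵥ (M *ᵥ b x)) S := by
  rw [contDiffOn_pi] at ha hb
  unfold dotProduct mulVec dotProduct
  exact ContDiffOn.sum fun i _ => (ha i).mul
    (ContDiffOn.sum fun j _ => contDiffOn_const.mul (hb j))

theorem fderiv_dotProduct_mulVec {X : Type*} [NormedAddCommGroup X] [NormedSpace ℝ X]
    {n m : ℕ} {x : X} {a : X → Fin n → ℝ} {b : X → Fin m → ℝ} (ha : DifferentiableAt ℝ a x)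
    (hb : DifferentiableAt ℝ b x) (M : Matrix (Fin n) (Fin m) ℝ) (u : X) :
    fderiv ℝ (fun x => a x ⬝ᵥ (M *ᵥ b x)) x u =
      fderiv ℝ a x u ⬝ᵥ (M *ᵥ b x) + a x ⬝ᵥ (M *ᵥ fderiv ℝ b x u) := by
  have ha' := hasFDerivAt_pi'.mp ha.hasFDerivAt
  have hb' := hasFDerivAt_pi'.mp hb.hasFDerivAt
  have h : HasFDerivAt (fun x => ∑ i, a x i * ∑ j, M i j * b x j) _ x :=
    HasFDerivAt.fun_sum fun i _ => (ha' i).mul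
      (HasFDerivAt.fun_sum fun j _ => (hb' j).const_mul (M i j))
  change fderiv ℝ (fun x => ∑ i, a x i * ∑ j, M i j * b x j) x u = _
  rw [h.fderiv]
  simp only [_root_.sum_apply, _root_.add_apply, _root_.smul_apply,
    ContinuousLinearMap.comp_apply, ContinuousLinearMap.proj_apply, smul_eq_mul, dotProduct,
    mulVec, Finset.sum_add_distrib]
  rw [add_comm]
  congr 1
  exact Finset.sum_congr rfl fun i _ => mul_comm _ _

theorem sum_Icc_telescope (T : ℕ → ℝ) (i : ℕ) :
    ∑ j ∈ Finset.Icc 1 i, (T (j - 1) - T j) = T 0 - T i := by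
  rw [Finset.sum_Icc_one_eq_sum_range]
  exact Finset.sum_range_sub' T i

variable {m n : ℕ} {Ω : Set (EuclideanSpace ℝ (Fin ℓ))} {N : ℕ}
  {P : Fin ℓ → ℕ → Matrix (Fin m) (Fin n) ℝ}
  {v : EuclideanSpace ℝ (Fin ℓ) → Fin m → ℝ} {w : EuclideanSpace ℝ (Fin ℓ) → Fin n → ℝ}

/-- The bilinear form `(∂_k^(i-j) w)ᵀ P_k(i)ᵀ ∂_k^(j-1) v` of which the boundary integrand is the
product with the `k`-th component of the normal vector. -/
noncomputable def boundaryForm (S : Set (EuclideanSpace ℝ (Fin ℓ))) (P : Fin ℓ → ℕ → Matrix (Fin m) (Fin n) ℝ)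
    (v : EuclideanSpace ℝ (Fin ℓ) → Fin m → ℝ) (w : EuclideanSpace ℝ (Fin ℓ) → Fin n → ℝ)
    (k : Fin ℓ) (i j : ℕ) (x : EuclideanSpace ℝ (Fin ℓ)) : ℝ :=
  pderivOn S k (i - j) w x ⬝ᵥ ((P k i)ᵀ *ᵥ pderivOn S k (j - 1) v x)

theorem boundaryIntegrand_eq (k : Fin ℓ) (i j : ℕ) :
    boundaryIntegrand Ω P v w k i j = fun s =>
      boundaryForm (closure Ω) P v w k i j s *
        inner ℝ (outwardNormal Ω s) (EuclideanSpace.single k 1) := by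
  funext s
  rw [boundaryIntegrand, boundaryForm, Matrix.smul_mulVec, dotProduct_smul, smul_eq_mul, mul_comm,
    EuclideanSpace.inner_single_right]
  simp

/-- Both derivative orders `i - j` and `j - 1` are at most `N - 1`, so each factor keeps one
continuous derivative. -/
theorem contDiffOn_boundaryForm {S : Set (EuclideanSpace ℝ (Fin ℓ))} (hS : UniqueDiffOn ℝ S)
    (hv : ContDiffOn ℝ N v S) (hw : ContDiffOn ℝ N w S) (k : Fin ℓ) {i j : ℕ}
    (hi : i ∈ Finset.Icc 1 N) (hj : j ∈ Finset.Icc 1 i) :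
    ContDiffOn ℝ 1 (boundaryForm S P v w k i j) S := by
  rw [Finset.mem_Icc] at hi hj
  have h1 : ContDiffOn ℝ (1 : ℕ) (pderivOn S k (i - j) w) S := hw.pderivOn hS k (by omega)
  have h2 : ContDiffOn ℝ (1 : ℕ) (pderivOn S k (j - 1) v) S := hv.pderivOn hS k (by omega)
  rw [Nat.cast_one] at h1 h2
  exact h1.dotProduct_mulVec h2 _

/-- The order `i - (j - 1)` is left in this form so that the two terms are one expression evaluated
at `j - 1` and at `j`, ready to telescope. -/
theorem fderiv_boundaryForm (hΩ : IsBoundedLipschitz Ω) (hv : ContDiffOn ℝ N v (closure Ω))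
    (hw : ContDiffOn ℝ N w (closure Ω)) (k : Fin ℓ) {i j : ℕ} (hi : i ∈ Finset.Icc 1 N)
    (hj : j ∈ Finset.Icc 1 i) {x : EuclideanSpace ℝ (Fin ℓ)} (hx : x ∈ Ω) :
    fderiv ℝ (boundaryForm (closure Ω) P v w k i j) x (EuclideanSpace.single k 1) =
      pderivOn (closure Ω) k (i - (j - 1)) w x ⬝ᵥ
          ((P k i)ᵀ *ᵥ pderivOn (closure Ω) k (j - 1) v x) +
        pderivOn (closure Ω) k (i - j) w x ⬝ᵥ ((P k i)ᵀ *ᵥ pderivOn (closure Ω) k j v x) := by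
  rw [Finset.mem_Icc] at hi hj
  have hS := hΩ.uniqueDiffOn_closure
  have hnhds : closure Ω ∈ 𝓝 x := Filter.mem_of_superset (hΩ.isOpen.mem_nhds hx) subset_closure
  have h1 : ContDiffOn ℝ (1 : ℕ) (pderivOn (closure Ω) k (i - j) w) (closure Ω) :=
    hw.pderivOn hS k (by omega)
  have h2 : ContDiffOn ℝ (1 : ℕ) (pderivOn (closure Ω) k (j - 1) v) (closure Ω) :=
    hv.pderivOn hS k (by omega)
  have e1 : i - (j - 1) = i - j + 1 := by omega
  obtain ⟨q, rfl⟩ : ∃ q, j = q + 1 := ⟨j - 1, by omega⟩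
  change fderiv ℝ (fun x => pderivOn (closure Ω) k (i - (q + 1)) w x ⬝ᵥ
    ((P k i)ᵀ *ᵥ pderivOn (closure Ω) k (q + 1 - 1) v x)) x _ = _
  rw [fderiv_dotProduct_mulVec ((h1.contDiffAt hnhds).differentiableAt (by simp))
    ((h2.contDiffAt hnhds).differentiableAt (by simp)), e1,
    ← fderivWithin_closure_eq_fderiv hΩ.isOpen hx, ← fderivWithin_closure_eq_fderiv hΩ.isOpen hx]
  rfl

theorem dotProduct_mulVec_eq_transpose (M : Matrix (Fin m) (Fin n) ℝ) (a : Fin m → ℝ)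
    (b : Fin n → ℝ) : a ⬝ᵥ (M *ᵥ b) = b ⬝ᵥ (Mᵀ *ᵥ a) := by
  rw [Matrix.dotProduct_mulVec, Matrix.mulVec_transpose, dotProduct_comm]

/-- The Lagrange identity: the volume integrand is a divergence. -/
theorem volumeIntegrand_eq_sum_fderiv (hΩ : IsBoundedLipschitz Ω) (P₀ : Matrix (Fin m) (Fin n) ℝ)
    (hv : ContDiffOn ℝ N v (closure Ω)) (hw : ContDiffOn ℝ N w (closure Ω))
    {x : EuclideanSpace ℝ (Fin ℓ)} (hx : x ∈ Ω) :
    volumeIntegrand (closure Ω) N P₀ P v w x =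
      ∑ k : Fin ℓ, ∑ i ∈ Finset.Icc 1 N, ∑ j ∈ Finset.Icc 1 i, (-1 : ℝ) ^ (j - 1) *
        fderiv ℝ (boundaryForm (closure Ω) P v w k i j) x (EuclideanSpace.single k 1) := by
  rw [volumeIntegrand, diffOp, diffOpAdjoint, dotProduct_add, dotProduct_add,
    dotProduct_mulVec_eq_transpose P₀, add_sub_add_left_eq_sub, dotProduct_sum, dotProduct_sum,
    ← Finset.sum_sub_distrib]
  refine Finset.sum_congr rfl fun k _ => ?_
  rw [dotProduct_sum, dotProduct_sum, ← Finset.sum_sub_distrib]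
  refine Finset.sum_congr rfl fun i hi => ?_
  -- The end terms `j = 0` and `j = i` are the contributions of `F` and of `F*` at order `i`.
  have htel := sum_Icc_telescope (fun j => (-1 : ℝ) ^ j *
    (pderivOn (closure Ω) k (i - j) w x ⬝ᵥ ((P k i)ᵀ *ᵥ pderivOn (closure Ω) k j v x))) i
  rw [Nat.sub_self, Nat.sub_zero, pow_zero, one_mul] at htel
  rw [dotProduct_mulVec_eq_transpose, Matrix.smul_mulVec, dotProduct_smul, smul_eq_mul]
  refine htel.symm.trans (Finset.sum_congr rfl fun j hj => ?_)
  rw [fderiv_boundaryForm hΩ hv hw k hi hj hx]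
  have hj1 : (-1 : ℝ) ^ j = -(-1 : ℝ) ^ (j - 1) := by
    obtain ⟨q, rfl⟩ : ∃ q, j = q + 1 := ⟨j - 1, by
      have := Finset.mem_Icc.mp hj
      omega⟩
    rw [pow_succ, Nat.add_sub_cancel]
    ring
  rw [hj1]
  ring

theorem matrixIntegrand_eq_sum_boundaryIntegrand (hN : 1 ≤ N) :
    matrixIntegrand Ω N P v w = fun s => ∑ k : Fin ℓ, ∑ i ∈ Finset.Icc 1 N,
      ∑ j ∈ Finset.Icc 1 i, (-1 : ℝ) ^ (j - 1) * boundaryIntegrand Ω P v w k i j s := by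
  funext s
  exact sumElim_dotProduct_boundaryMatrix_mulVec P (outwardNormal Ω s) hN
    (a := fun k i => pderivOn (closure Ω) k i w s) (b := fun k i => pderivOn (closure Ω) k i v s)
    (fun _ => rfl) fun _ => rfl

end Green

/-! ### The Green formula. -/

theorem lemma1 {ℓ m n : ℕ} (N : ℕ) (hN : 1 ≤ N)
    (P₀ : Matrix (Fin m) (Fin n) ℝ) (P : Fin ℓ → ℕ → Matrix (Fin m) (Fin n) ℝ)
    (Ω : Set (EuclideanSpace ℝ (Fin ℓ))) (hΩ : IsBoundedLipschitz Ω)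
    (v : EuclideanSpace ℝ (Fin ℓ) → Fin m → ℝ) (hv : ContDiffOn ℝ N v (closure Ω))
    (w : EuclideanSpace ℝ (Fin ℓ) → Fin n → ℝ) (hw : ContDiffOn ℝ N w (closure Ω)) :
    (∀ᵐ s ∂(surfaceMeasure Ω), IsOutwardUnitNormal Ω s (outwardNormal Ω s)) ∧
    IntegrableOn (volumeIntegrand (closure Ω) N P₀ P v w) Ω volume ∧
    (∀ k : Fin ℓ, ∀ i ∈ Finset.Icc 1 N, ∀ j ∈ Finset.Icc 1 i,
      Integrable (boundaryIntegrand Ω P v w k i j) (surfaceMeasure Ω)) ∧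
    Integrable (matrixIntegrand Ω N P v w) (surfaceMeasure Ω) ∧
    (∫ x in Ω, volumeIntegrand (closure Ω) N P₀ P v w x) =
      ∑ k : Fin ℓ, ∑ i ∈ Finset.Icc 1 N, ∑ j ∈ Finset.Icc 1 i,
        (-1 : ℝ) ^ (j - 1) * ∫ s, boundaryIntegrand Ω P v w k i j s ∂(surfaceMeasure Ω) ∧
    (∑ k : Fin ℓ, ∑ i ∈ Finset.Icc 1 N, ∑ j ∈ Finset.Icc 1 i,
        (-1 : ℝ) ^ (j - 1) * ∫ s, boundaryIntegrand Ω P v w k i j s ∂(surfaceMeasure Ω)) =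
      ∫ s, matrixIntegrand Ω N P v w s ∂(surfaceMeasure Ω) := by
  have hform : ∀ k : Fin ℓ, ∀ i ∈ Finset.Icc 1 N, ∀ j ∈ Finset.Icc 1 i,
      ContDiffOn ℝ 1 (boundaryForm (closure Ω) P v w k i j) (closure Ω) := fun k i hi j hj =>
    contDiffOn_boundaryForm hΩ.uniqueDiffOn_closure hv hw k hi hj
  have hbint : ∀ k : Fin ℓ, ∀ i ∈ Finset.Icc 1 N, ∀ j ∈ Finset.Icc 1 i,
      Integrable (boundaryIntegrand Ω P v w k i j) (surfaceMeasure Ω) := fun k i hi j hj => by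
    rw [boundaryIntegrand_eq]
    exact hΩ.integrable_mul_inner_outwardNormal (hform k i hi j hj).continuousOn _
  have hvint : ∀ k : Fin ℓ, ∀ i ∈ Finset.Icc 1 N, ∀ j ∈ Finset.Icc 1 i,
      IntegrableOn (fun x => (-1 : ℝ) ^ (j - 1) *
        fderiv ℝ (boundaryForm (closure Ω) P v w k i j) x (EuclideanSpace.single k 1)) Ω :=
    fun k i hi j hj => (hΩ.integrableOn_fderiv (hform k i hi j hj) _).const_mul _
  have hvol := fun x (hx : x ∈ Ω) => volumeIntegrand_eq_sum_fderiv (P := P) hΩ P₀ hv hw hx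
  refine ⟨hΩ.ae_exists_isOutwardUnitNormal, ?_, hbint, ?_, ?_, ?_⟩
  · refine IntegrableOn.congr_fun ?_ (fun x hx => (hvol x hx).symm) hΩ.isOpen.measurableSet
    exact integrable_finsetSum _ fun k _ => integrable_finsetSum _ fun i hi =>
      integrable_finsetSum _ fun j hj => hvint k i hi j hj
  · rw [matrixIntegrand_eq_sum_boundaryIntegrand hN]
    exact integrable_finsetSum _ fun k _ => integrable_finsetSum _ fun i hi =>
      integrable_finsetSum _ fun j hj => (hbint k i hi j hj).const_mul _
  · rw [setIntegral_congr_fun hΩ.isOpen.measurableSet hvol,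
      integral_finsetSum _ fun k _ => integrable_finsetSum _ fun i hi =>
        integrable_finsetSum _ fun j hj => hvint k i hi j hj]
    refine Finset.sum_congr rfl fun k _ => ?_
    rw [integral_finsetSum _ fun i hi => integrable_finsetSum _ fun j hj => hvint k i hi j hj]
    refine Finset.sum_congr rfl fun i hi => ?_
    rw [integral_finsetSum _ fun j hj => hvint k i hi j hj]
    refine Finset.sum_congr rfl fun j hj => ?_
    rw [integral_const_mul, hΩ.integral_fderiv_eq (hform k i hi j hj), boundaryIntegrand_eq]
  · rw [matrixIntegrand_eq_sum_boundaryIntegrand hN,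
      integral_finsetSum _ fun k _ => integrable_finsetSum _ fun i hi =>
        integrable_finsetSum _ fun j hj => (hbint k i hi j hj).const_mul _]
    refine Finset.sum_congr rfl fun k _ => ?_
    rw [integral_finsetSum _ fun i hi => integrable_finsetSum _ fun j hj =>
      (hbint k i hi j hj).const_mul _]
    refine Finset.sum_congr rfl fun i hi => ?_
    rw [integral_finsetSum _ fun j hj => (hbint k i hi j hj).const_mul _]
    exact Finset.sum_congr rfl fun j hj => (integral_const_mul _ _).symm
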